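/- **Setting.** Consider an episodic MDP with horizon $H\ge 1$, a measurable state space $\mathcal S$, a finite nonempty action set $\mathcal A$, a fixed initial state $s_1$, transition kernels $\mathbb P_h$ and deterministic measurable rewards $r_h\ge 0$ such that $\sum_{h=1}^H r_h(s_h,a_h)\le 1$ along every possible trajectory. Let $V^\pi_h$ be the value function of a deterministic Markov policy $\pi$, let $V^\star_h=\sup_\pi V_h^\pi$, and let $Q^\star_h=\sup_\pi Q^\pi_h$. A policy $\pi$ is $\eta$-optimal if $V_1^\pi(s_1)\ge V_1^\star(s_1)-\eta$. The Bellman operator is $(\mathcal T_h g)(s,a)=r_h(s,a)+\mathbb E_{s'\sim\mathbb P_h(\cdot\mid s,a)}\max_{a'}g(s',a')$. Let $\mathcal F=\mathcal F_1\times\dots\times\mathcal F_H$ and $\mathcal G=\mathcal G_1\times\dots\times\mathcal G_H$, where $\mathcal F_h,\mathcal G_h$ are classes of measurable functions $\mathcal S\times\mathcal A\to[0,1]$; put $f_{H+1}=0$. For $f\in\mathcal F$ let $\pi_f$ be its greedy policy, $\pi_{f,h}(s)=\pi_{f_h}(s)\in\arg\max_a f_h(s,a)$, with a fixed measurable tie-breaking.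 Let $\mathcal N_{\mathcal F\cup\mathcal G}(\rho)$ be the least cardinality of a $\rho$-cover of $\mathcal F\cup\mathcal G$ by its own elements in the metric $\max_h\|f_h-g_h\|_\infty$. Assume *realizability*, $Q^\star_h\in\mathcal F_h$ for all $h\in[H]$, and *generalized completeness*, $\mathcal T_h\mathcal F_{h+1}\subseteq\mathcal G_h$ for all $h\in[H]$ (with $\mathcal F_{H+1}=\{0\}$). **Dimension.** For a class $\Phi$ of functions on $\mathcal S$ and a family $\Pi$ of probability measures on $\mathcal S$, $\dim_{\rm DE}(\Phi,\Pi,\epsilon)$ is the length of the longest sequence $\rho_1,\dots,\rho_n\in\Pi$ for which there is $\epsilon'\ge\epsilon$ such that for every $i$ some $g\in\Phi$ satisfies $\big(\sum_{j<i}(\mathbb E_{\rho_j}g)^2\big)^{1/2}\le\epsilon'<|\mathbb E_{\rho_i}g|$. For $\Pi=(\Pi_h)_{h\in[H]}$ let $\dim_{\rm VBE}(\mathcal F,\Pi,\epsilon)=\max_{h\in[H]}\dim_{\rm DE}(\Phi_h,\Pi_h,\epsilon)$, where $\Phi_h=\{s\mapsto (f_h-\mathcal T_hf_{h+1})(s,\pi_{f_h}(s)):f\in\mathcal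 F\}$. Let $\mathcal D_{\mathcal F}$ consist of the laws of $s_h$ under the policies $\pi_f$, $f\in\mathcal F$, and let $\mathcal D_\Delta$ consist of all point masses on $\mathcal S$. **Algorithm (V-type GOLF with parameters $K\ge1$, $\beta$).** Let $\mathcal B^0=\mathcal F$. In epoch $k=1,\dots,K$: choose $f^k\in\arg\max_{f\in\mathcal B^{k-1}}f_1(s_1,\pi_f(s_1))$ (measurably in the data collected so far; it is required that the maximum is attained whenever $\mathcal B^{k-1}\neq\emptyset$, and $f^k\in\mathcal F$ is arbitrary if $\mathcal B^{k-1}=\emptyset$) and put $\pi^k=\pi_{f^k}$. For each $h\in[H]$, in a separate episode, follow $\pi^k$ at steps $1,\dots,h-1$, take a uniformly random action at step $h$, and add the tuple $(s_h,a_h,r_h,s_{h+1})$ to $\mathcal D_h$. Let $$\mathcal B^k=\Big\{f\in\mathcal F:\ \mathcal L_{\mathcal D_h}(f_h,f_{h+1})\le\inf_{g\in\mathcal G_h}\mathcal L_{\mathcal D_h}(g,f_{h+1})+\beta\ \text{ for all } h\in[H]\Big\},$$ $$\mathcal L_{\mathcal D_h}(\xi,\zeta)=\sum_{(s,a,r,s')\in\mathcal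 D_h}\big[\xi(s,a)-r-\max_{a'}\zeta(s',a')\big]^2 .$$ The output $\pi^{\rm out}$ is drawn uniformly at random from $\pi^1,\dots,\pi^K$. **Theorem.** For every $B\ge1$ there are constants $c,C_1,C_2>0$, depending on $B$ only, such that the following holds for every MDP and all classes as above and every $\epsilon>0$. Let $$d=\max\Big\{1,\min_{\Pi\in\{\mathcal D_\Delta,\mathcal D_{\mathcal F}\}}\dim_{\rm VBE}(\mathcal F,\Pi,\epsilon/H)\Big\},\qquad \rho=\frac{\epsilon^2}{H^2d|\mathcal A|},$$ $$T=\frac{H^2d|\mathcal A|}{\epsilon^2}\log\Big[\mathcal N_{\mathcal F\cup\mathcal G}(\rho)\cdot\frac{Hd|\mathcal A|}{\epsilon}\Big],$$ and assume that $d$ and $\mathcal N_{\mathcal F\cup\mathcal G}(\rho)$ are finite. Let $K\ge1$ be an integer with $K\ge C_1T$, and suppose that either * $\beta=c\,\log[KH\,\mathcal N_{\mathcal F\cup\mathcal G}(\rho)]$ and $K\le B\,C_1T$, or * $\beta=c\,\big(\log[KH\,\mathcal N_{\mathcal F\cup\mathcal G}(\rho)]+K\rho\big)$. Then the output $\pi^{\rm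 out}$ of V-type GOLF is $C_2\epsilon$-optimal with probability at least $0.99$. -/

import Mathlib

open MeasureTheory ProbabilityTheory

namespace VGolf

noncomputable section

universe u v

/-- Along every trajectory of `n` steps that is possible from state `s` at step `h`, whatever the
actions, the collected rewards sum to at most `b` (almost surely in the transitions). -/
def RewardSumLE {S : Type u} {A : Type v} [MeasurableSpace S] [MeasurableSpace A]
    (P : ℕ → Kernel (S × A) S) (r : ℕ → S → A → ℝ) : ℕ → ℕ → S → ℝ → Prop
  | 0, _, _, b => 0 ≤ b
  | n + 1, h, s, b =>
      ∀ a : A, ∀ᵐ s' ∂(P h (s, a)), RewardSumLE P r n (h + 1) s' (b - r h s a)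

/-- An episodic Markov decision process. Steps are numbered `0, …, H - 1`; the values of `P` and
`r` at indices `≥ H` play no role. -/
structure MDP (S : Type u) (A : Type v) [MeasurableSpace S] [MeasurableSpace A] where
  /-- length of an episode -/
  H : ℕ
  H_pos : 0 < H
  /-- transition probabilities -/
  P : ℕ → Kernel (S × A) S
  markov : ∀ h, IsMarkovKernel (P h)
  /-- deterministic rewards -/
  r : ℕ → S → A → ℝ
  r_measurable : ∀ h, Measurable (fun p : S × A => r h p.1 p.2)
  r_nonneg : ∀ h s a, 0 ≤ r h s a
  /-- the fixed initial state -/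
  s₁ : S
  r_sum_le : RewardSumLE P r H 0 s₁ 1

section Dimension

variable {X : Type u} [MeasurableSpace X]

/-- `ν` is `ε`-independent of `μ 0, …, μ (n - 1)` with respect to the function class `Φ`. -/
def IndepOf (Φ : Set (X → ℝ)) (ε : ℝ) (ν : Measure X) {n : ℕ} (μ : Fin n → Measure X) : Prop :=
  ∃ g ∈ Φ, Real.sqrt (∑ i, (∫ x, g x ∂(μ i)) ^ 2) ≤ ε ∧ ε < |∫ x, g x ∂ν|

/-- Distributional Eluder dimension: the length of the longest sequence in `Λ` such that, for some
`ε' ≥ ε`, every member is `ε'`-independent of its predecessors (`⊤` if there is no longest one). -/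
def dimDE (Φ : Set (X → ℝ)) (Λ : Set (Measure X)) (ε : ℝ) : ℕ∞ :=
  ⨆ (n : ℕ) (_ : ∃ μ : Fin n → Measure X, (∀ i, μ i ∈ Λ) ∧ ∃ ε' : ℝ, ε ≤ ε' ∧
    ∀ i : Fin n, IndepOf Φ ε' (μ i) (fun j : Fin i => μ (Fin.castLE i.isLt.le j))), (n : ℕ∞)

end Dimension

section CoveringNumber

variable {S : Type u} {A : Type v}

/-- Covering number of `V` at scale `ρ` (centres in `V`), for the distance
`max_h ‖f_h - g_h‖_∞`. -/
def coveringNumber (V : Set (ℕ → S → A → ℝ)) (ρ : ℝ) : ℕ∞ :=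
  ⨅ (V₀ : Set (ℕ → S → A → ℝ))
    (_ : V₀ ⊆ V ∧ ∀ f ∈ V, ∃ g ∈ V₀, ∀ h s a, |f h s a - g h s a| ≤ ρ), V₀.encard

end CoveringNumber

namespace MDP

variable {S : Type u} {A : Type v} [MeasurableSpace S] [MeasurableSpace A]

section Values

variable (M : MDP S A)

/-- Law of the state reached `n` steps later when `π` is followed from state `s` at step `h`. -/
def stateLaw (π : ℕ → S → A) (h : ℕ) (s : S) : ℕ → Measure S
  | 0 => Measure.dirac s
  | n + 1 => (stateLaw π h s n).bind (fun s' => M.P (h + n) (s', π (h + n) s'))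

/-- `V^π_h(s)`: expected sum of the rewards collected at steps `h, …, H - 1` by `π`,
starting from `s` at step `h`. -/
def V (π : ℕ → S → A) (h : ℕ) (s : S) : ℝ :=
  ∑ n ∈ Finset.range (M.H - h),
    ∫ s', M.r (h + n) s' (π (h + n) s') ∂(M.stateLaw π h s n)

/-- `Q^π_h(s, a)`. -/
def Q (π : ℕ → S → A) (h : ℕ) (s : S) (a : A) : ℝ :=
  M.r h s a + ∫ s', M.V π (h + 1) s' ∂(M.P h (s, a))

/-- Deterministic (measurable) policies. -/
def Policy : Type (max u v) := {π : ℕ → S → A // ∀ h < M.H, Measurable (π h)}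

/-- Optimal value function. -/
def Vstar (h : ℕ) (s : S) : ℝ := ⨆ π : M.Policy, M.V π.1 h s

/-- Optimal `Q`-value function. -/
def Qstar (h : ℕ) (s : S) (a : A) : ℝ := ⨆ π : M.Policy, M.Q π.1 h s a

/-- `π` is `ε`-optimal. -/
def IsOptimalUpTo (ε : ℝ) (π : ℕ → S → A) : Prop := M.Vstar 0 M.s₁ - ε ≤ M.V π 0 M.s₁

/-- Bellman operator `𝒯_h`. -/
def bellman (h : ℕ) (g : S → A → ℝ) (s : S) (a : A) : ℝ :=
  M.r h s a + ∫ s', (⨆ a', g s' a') ∂(M.P h (s, a))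

end Values

section Classes

variable (M : MDP S A)

/-- Every member of `F h` is a measurable function with values in `[0, 1]`. -/
def IsValueClass (F : ℕ → Set (S → A → ℝ)) : Prop :=
  ∀ h < M.H, ∀ g ∈ F h, Measurable (fun p : S × A => g p.1 p.2) ∧ ∀ s a, g s a ∈ Set.Icc 0 1

/-- The product class `F_0 × ⋯ × F_{H-1}`; each tuple is extended by `0` from step `H` on. -/
def tuples (F : ℕ → Set (S → A → ℝ)) : Set (ℕ → S → A → ℝ) :=
  {f | (∀ h < M.H, f h ∈ F h) ∧ ∀ h, M.H ≤ h → f h = 0}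

def Realizable (F : ℕ → Set (S → A → ℝ)) : Prop := ∀ h < M.H, M.Qstar h ∈ F h

def GeneralizedComplete (F G : ℕ → Set (S → A → ℝ)) : Prop :=
  ∀ f ∈ M.tuples F, ∀ h < M.H, M.bellman h (f (h + 1)) ∈ G h

/-- `σ h g` is a choice of the greedy action map `s ↦ argmax_a g(s, a)` for `g ∈ F h`
(ties broken in any measurable way). -/
def IsGreedy (F : ℕ → Set (S → A → ℝ)) (σ : ℕ → (S → A → ℝ) → S → A) : Prop :=
  ∀ h < M.H, ∀ g ∈ F h, Measurable (σ h g) ∧ ∀ s a, g s a ≤ g s (σ h g s)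

/-- The greedy policy `π_f`. -/
def greedyPolicy (σ : ℕ → (S → A → ℝ) → S → A) (f : ℕ → S → A → ℝ) : ℕ → S → A :=
  fun h => σ h (f h)

/-- State-wise Bellman residual class `(I - 𝒯_h) V_F`. -/
def residualClass (F : ℕ → Set (S → A → ℝ)) (σ : ℕ → (S → A → ℝ) → S → A) (h : ℕ) :
    Set (S → ℝ) :=
  {φ | ∃ f ∈ M.tuples F,
    φ = fun s => f h s (σ h (f h) s) - M.bellman h (f (h + 1)) s (σ h (f h) s)}

/-- V-type Bellman Eluder dimension with respect to the families `Λ h` of state distributions. -/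
def dimVBE (F : ℕ → Set (S → A → ℝ)) (σ : ℕ → (S → A → ℝ) → S → A)
    (Λ : ℕ → Set (Measure S)) (ε : ℝ) : ℕ∞ :=
  ⨆ h : Fin M.H, dimDE (M.residualClass F σ h) (Λ h) ε

/-- State distributions at step `h` generated by rolling in with greedy policies of the class. -/
def rollInLaws (F : ℕ → Set (S → A → ℝ)) (σ : ℕ → (S → A → ℝ) → S → A) (h : ℕ) :
    Set (Measure S) :=
  {μ | ∃ f ∈ M.tuples F, μ = M.stateLaw (greedyPolicy σ f) 0 M.s₁ h}

/-- Point masses. -/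
def diracLaws (S : Type u) [MeasurableSpace S] (_h : ℕ) : Set (Measure S) :=
  Set.range Measure.dirac

/-- `min_{Λ ∈ {𝒟_Δ, 𝒟_F}} dim_VBE(F, Λ, ε)`. -/
def minDimVBE (F : ℕ → Set (S → A → ℝ)) (σ : ℕ → (S → A → ℝ) → S → A) (ε : ℝ) : ℕ∞ :=
  min (M.dimVBE F σ (diracLaws S) ε) (M.dimVBE F σ (M.rollInLaws F σ) ε)

end Classes

section Algorithm

variable (M : MDP S A)

/-- Data of one epoch: for each step `h` a tuple `(s_h, a_h, r_h, s_{h+1})`. -/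
abbrev Epoch : Type (max u v) := Fin M.H → S × A × ℝ × S

/-- Law of the tuple collected by following `π` before step `h` and taking a uniformly random
action at step `h`. -/
def tupleLaw (π : ℕ → S → A) (h : ℕ) : Measure (S × A × ℝ × S) :=
  (M.stateLaw π 0 M.s₁ h).bind fun s =>
    (uniformOn (Set.univ : Set A)).bind fun a =>
      (M.P h (s, a)).map fun s' => (s, a, M.r h s a, s')

/-- Law of the data of one epoch run with `π`: one separate episode for every step. -/
def epochLaw (π : ℕ → S → A) : Measure M.Epoch :=
  Measure.pi fun h : Fin M.H => M.tupleLaw π h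

/-- Squared loss of `ξ` at step `h` on the data `D` of `k` epochs, with targets built from `ζ`. -/
def loss {k : ℕ} (D : Fin k → M.Epoch) (h : Fin M.H) (ξ ζ : S → A → ℝ) : ℝ :=
  ∑ i, (ξ (D i h).1 (D i h).2.1 - (D i h).2.2.1 - ⨆ a', ζ (D i h).2.2.2 a') ^ 2

/-- Confidence set after `k` epochs with data `D`; for `k = 0` all losses vanish and it is the
whole class (as `β ≥ 0`). -/
def confidenceSet (F G : ℕ → Set (S → A → ℝ)) (β : ℝ) {k : ℕ} (D : Fin k → M.Epoch) :
    Set (ℕ → S → A → ℝ) :=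
  {f | f ∈ M.tuples F ∧ ∀ h : Fin M.H,
    M.loss D h (f h) (f (h + 1)) ≤ (⨅ g : G h, M.loss D h g.1 (f (h + 1))) + β}

/-- `sel k D` is the function chosen in the epoch that follows `k < K` epochs with data `D`. It is a
member of the class that maximizes the optimistic initial value `f(s₁, π_f(s₁))` over the
confidence set; it is unconstrained within the class if the confidence set is empty. The choice
depends measurably on the data. -/
structure IsVGolf (F G : ℕ → Set (S → A → ℝ)) (σ : ℕ → (S → A → ℝ) → S → A) (K : ℕ)
    (β : ℝ) (sel : (k : ℕ) → (Fin k → M.Epoch) → ℕ → S → A → ℝ) : Prop where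
  mem : ∀ k < K, ∀ D, sel k D ∈ M.tuples F
  argmax : ∀ k < K, ∀ D, (M.confidenceSet F G β D).Nonempty →
    sel k D ∈ M.confidenceSet F G β D ∧
      ∀ f ∈ M.confidenceSet F G β D,
        f 0 M.s₁ (greedyPolicy σ f 0 M.s₁) ≤
          sel k D 0 M.s₁ (greedyPolicy σ (sel k D) 0 M.s₁)
  measurable_value : ∀ k < K, ∀ h < M.H,
    Measurable (fun p : (Fin k → M.Epoch) × S × A => sel k p.1 h p.2.1 p.2.2)
  measurable_policy : ∀ k < K, ∀ h < M.H,
    Measurable (fun p : (Fin k → M.Epoch) × S => greedyPolicy σ (sel k p.1) h p.2)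

/-- Law of the data of the first `k` epochs. -/
def dataLaw (σ : ℕ → (S → A → ℝ) → S → A)
    (sel : (k : ℕ) → (Fin k → M.Epoch) → ℕ → S → A → ℝ) :
    (k : ℕ) → Measure (Fin k → M.Epoch)
  | 0 => Measure.dirac Fin.elim0
  | k + 1 => (dataLaw σ sel k).bind fun D =>
      (M.epochLaw (greedyPolicy σ (sel k D))).map fun e =>
        (Fin.snoc D e : Fin (k + 1) → M.Epoch)

/-- The policy followed in epoch `k` of a run with data `D`. -/
def policyAt (σ : ℕ → (S → A → ℝ) → S → A)
    (sel : (k : ℕ) → (Fin k → M.Epoch) → ℕ → S → A → ℝ) {K : ℕ}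
    (D : Fin K → M.Epoch) (k : Fin K) : ℕ → S → A :=
  greedyPolicy σ (sel k fun i => D (Fin.castLE k.isLt.le i))

/-- Probability, over the data of `K` epochs and a uniformly random index `k`, that the output
policy `π^out = π^k` satisfies `p`. -/
def outputProb (σ : ℕ → (S → A → ℝ) → S → A)
    (sel : (k : ℕ) → (Fin k → M.Epoch) → ℕ → S → A → ℝ) (K : ℕ)
    (p : (ℕ → S → A) → Prop) : ENNReal :=
  ((M.dataLaw σ sel K).prod (uniformOn (Set.univ : Set (Fin K))))
    {x | p (M.policyAt σ sel x.1 x.2)}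

end Algorithm

end MDP

/-- The scale `ε² / (H² d |A|)`. -/
def scale (H d nA : ℕ) (ε : ℝ) : ℝ := ε ^ 2 / ((H : ℝ) ^ 2 * d * nA)

/-- `(H² d |A| / ε²) · log (N · H d |A| / ε)`. -/
def sampleSize (H d nA N : ℕ) (ε : ℝ) : ℝ :=
  ((H : ℝ) ^ 2 * d * nA / ε ^ 2) * Real.log (N * ((H : ℝ) * d * nA / ε))

end

end VGolf

/-!
If `Q^⋆` lies in the confidence set, optimism and telescoping along the greedy policy bound the
regret of epoch `k` by the sum over `h` of the mean Bellman residuals of `f^k` at the greedy action,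
under the law of `s_h` generated by `π^k`.

Given its state and action, the excess of the squared loss over that of the Bellman backup has mean
equal to the squared residual and second moment of the same order. The compensated losses therefore
form an exponential supermartingale, and a union bound over a `ρ`-cover and over the epochs shows
that, with high probability, `Q^⋆` is in all confidence sets and each `f^k` has small squared
residual on the past. The uniformly random action costs a factor `|A|`.

The past is measured in mean squared residuals under test laws of `s_h`: either the point mass at
the observed state or the law of `s_h` under `π^i`. In both cases the loss has the right conditional
mean, so that one argument serves `𝒟_Δ` and `𝒟_F`. The Eluder dimension with respect to the test
laws turns the bound on the past into a bound on the expected sum of residuals over all epochs,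
which controls the output policy by Markov's inequality.
-/

namespace VGolf

open scoped ENNReal

noncomputable section

/-! ### Adaptive sampling -/

section MeasurableFamily

variable {Ω X Y : Type*} [MeasurableSpace Ω] [MeasurableSpace X] [MeasurableSpace Y]
  {κ : Ω → Measure X} [∀ ω, IsProbabilityMeasure (κ ω)]

theorem measurable_lintegral_of_family (hκ : Measurable κ) {g : Ω → X → ℝ≥0∞}
    (hg : Measurable (Function.uncurry g)) : Measurable fun ω => ∫⁻ x, g ω x ∂κ ω :=
  have : IsMarkovKernel (⟨κ, hκ⟩ : Kernel Ω X) := ⟨inferInstance⟩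
  Measurable.lintegral_kernel_prod_right (κ := ⟨κ, hκ⟩) hg

theorem measurable_integral_of_family (hκ : Measurable κ) {g : Ω → X → ℝ}
    (hg : Measurable (Function.uncurry g)) : Measurable fun ω => ∫ x, g ω x ∂κ ω :=
  have : IsMarkovKernel (⟨κ, hκ⟩ : Kernel Ω X) := ⟨inferInstance⟩
  (StronglyMeasurable.integral_kernel_prod_right' (κ := ⟨κ, hκ⟩) hg.stronglyMeasurable).measurable

theorem measurable_bind_of_family (hκ : Measurable κ) {η : Ω → X → Measure Y}
    (hη : Measurable (Function.uncurry η)) : Measurable fun ω => (κ ω).bind (η ω) := by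
  refine Measure.measurable_of_measurable_coe _ fun s hs => ?_
  have hbind (ω : Ω) : (κ ω).bind (η ω) s = ∫⁻ x, η ω x s ∂κ ω :=
    Measure.bind_apply hs (hη.comp measurable_prodMk_left).aemeasurable
  simp_rw [hbind]
  exact measurable_lintegral_of_family hκ ((Measure.measurable_coe hs).comp hη)

theorem measurable_map_of_family (hκ : Measurable κ) {g : Ω → X → Y}
    (hg : Measurable (Function.uncurry g)) : Measurable fun ω => (κ ω).map (g ω) := by
  have hmap (ω : Ω) : (κ ω).map (g ω) = (κ ω).bind fun x => Measure.dirac (g ω x) :=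
    (Measure.bind_dirac_eq_map _ (hg.comp measurable_prodMk_left)).symm
  simp_rw [hmap]
  exact measurable_bind_of_family hκ (Measure.measurable_dirac.comp hg)

theorem measurable_pi_of_family {ι : Type*} [Fintype ι] {κ : Ω → ι → Measure X}
    [∀ ω i, IsProbabilityMeasure (κ ω i)] (hκ : ∀ i, Measurable fun ω => κ ω i) :
    Measurable fun ω => Measure.pi (κ ω) := by
  refine Measurable.measure_of_isPiSystem_of_isProbabilityMeasure generateFrom_pi.symm
    isPiSystem_pi ?_
  rintro _ ⟨s, hs, rfl⟩
  simp_rw [Measure.pi_pi]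
  exact Finset.measurable_prod _ fun i _ =>
    (Measure.measurable_coe (hs i (Set.mem_univ i))).comp (hκ i)

end MeasurableFamily

theorem lintegral_uniformOn_univ {X : Type*} [MeasurableSpace X] [MeasurableSingletonClass X]
    [Fintype X] (f : X → ℝ≥0∞) :
    ∫⁻ x, f x ∂(uniformOn (Set.univ : Set X)) = (Fintype.card X : ℝ≥0∞)⁻¹ * ∑ x, f x := by
  simp [lintegral_fintype, uniformOn_univ, ← Finset.sum_mul, mul_comm]

theorem take_snoc {E : Type*} {n k : ℕ} (hk : k ≤ n) (D : Fin n → E) (e : E) :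
    Fin.take k (hk.trans n.le_succ) (Fin.snoc D e : Fin (n + 1) → E) = Fin.take k hk D := by
  funext i
  exact Fin.snoc_castSucc (α := fun _ => E) e D (Fin.castLE hk i)

section AdaptiveSampling

variable {E : Type*}

/-- The sum of `w k D e` over the observations `e` of a sequence, where `D` stands for the `k`
observations before `e`. -/
def predictableSum (w : (k : ℕ) → (Fin k → E) → E → ℝ) {n : ℕ} (D : Fin n → E) : ℝ :=
  ∑ i : Fin n, w i (Fin.take i i.2.le D) (D i)

theorem predictableSum_snoc (w : (k : ℕ) → (Fin k → E) → E → ℝ) {n : ℕ} (D : Fin n → E) (e : E) :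
    predictableSum w (Fin.snoc D e : Fin (n + 1) → E) = predictableSum w D + w n D e := by
  simp only [predictableSum, Fin.sum_univ_castSucc, Fin.snoc_castSucc, Fin.snoc_last,
    Fin.val_castSucc, Fin.val_last]
  congr 1
  · exact Finset.sum_congr rfl fun i _ => congrArg (fun q => w i q (D i)) (take_snoc i.2.le D e)
  · exact congrArg (fun q => w n q e) (take_snoc le_rfl D e)

variable [MeasurableSpace E]

theorem measurable_take {n k : ℕ} (hk : k ≤ n) : Measurable fun D : Fin n → E => Fin.take k hk D :=
  measurable_pi_lambda _ fun _ => measurable_pi_apply _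

theorem measurable_snoc (k : ℕ) :
    Measurable fun p : (Fin k → E) × E => (Fin.snoc p.1 p.2 : Fin (k + 1) → E) := by
  refine measurable_pi_lambda _ fun i => ?_
  refine Fin.lastCases ?_ (fun j => ?_) i
  · simpa using measurable_snd
  · simp only [Fin.snoc_castSucc]
    exact (measurable_pi_apply j).comp measurable_fst

theorem measurable_snoc_right {k : ℕ} (D : Fin k → E) :
    Measurable fun e => (Fin.snoc D e : Fin (k + 1) → E) :=
  (measurable_snoc k).comp measurable_prodMk_left

theorem measurable_predictableSum {w : (k : ℕ) → (Fin k → E) → E → ℝ} {n : ℕ}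
    (hw : ∀ k < n, Measurable (Function.uncurry (w k))) :
    Measurable fun D : Fin n → E => predictableSum w D :=
  Finset.measurable_sum _ fun i _ =>
    (hw i i.2).comp ((measurable_take _).prodMk (measurable_pi_apply _))

/-- Law of `k` successive observations, where `κ j D` is the law of the observation that follows
the `j` observations `D`. -/
def adaptiveLaw (κ : (k : ℕ) → (Fin k → E) → Measure E) : (k : ℕ) → Measure (Fin k → E)
  | 0 => Measure.dirac Fin.elim0
  | k + 1 => (adaptiveLaw κ k).bind fun D => (κ k D).map fun e => (Fin.snoc D e : Fin (k + 1) → E)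

/-- The first `K` sampling laws are probability measures that depend measurably on the data. -/
structure IsAdaptiveSampling (κ : (k : ℕ) → (Fin k → E) → Measure E) (K : ℕ) : Prop where
  measurable : ∀ k < K, Measurable (κ k)
  isProbabilityMeasure : ∀ k < K, ∀ D, IsProbabilityMeasure (κ k D)

namespace IsAdaptiveSampling

variable {κ : (k : ℕ) → (Fin k → E) → Measure E} {K k n : ℕ}

theorem measurable_map_snoc (h : IsAdaptiveSampling κ K) (hk : k < K) :
    Measurable fun D => (κ k D).map fun e => (Fin.snoc D e : Fin (k + 1) → E) :=
  have := h.isProbabilityMeasure k hk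
  measurable_map_of_family (h.measurable k hk) (measurable_snoc k)

theorem isProbabilityMeasure_adaptiveLaw (h : IsAdaptiveSampling κ K) :
    ∀ k ≤ K, IsProbabilityMeasure (adaptiveLaw κ k)
  | 0, _ => by rw [adaptiveLaw]; infer_instance
  | k + 1, hk => by
    have := h.isProbabilityMeasure_adaptiveLaw k (by omega)
    have := h.isProbabilityMeasure k hk
    exact isProbabilityMeasure_bind (h.measurable_map_snoc hk).aemeasurable
      (.of_forall fun D => Measure.isProbabilityMeasure_map (measurable_snoc_right D).aemeasurable)

theorem lintegral_succ (h : IsAdaptiveSampling κ K) (hk : k < K)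
    {g : (Fin (k + 1) → E) → ℝ≥0∞} (hg : Measurable g) :
    ∫⁻ D, g D ∂adaptiveLaw κ (k + 1) =
      ∫⁻ D, ∫⁻ e, g (Fin.snoc D e) ∂κ k D ∂adaptiveLaw κ k := by
  rw [adaptiveLaw, Measure.lintegral_bind (h.measurable_map_snoc hk).aemeasurable hg.aemeasurable]
  simp_rw [lintegral_map hg (measurable_snoc_right _)]

theorem lintegral_take (h : IsAdaptiveSampling κ K) {g : (Fin k → E) → ℝ≥0∞}
    (hg : Measurable g) (hkn : k ≤ n) (hn : n ≤ K) :
    ∫⁻ D, g (Fin.take k hkn D) ∂adaptiveLaw κ n = ∫⁻ D, g D ∂adaptiveLaw κ k := by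
  induction n, hkn using Nat.le_induction with
  | base => simp
  | succ n hkn ih =>
    have := h.isProbabilityMeasure n hn
    refine (h.lintegral_succ hn (hg.comp (measurable_take _))).trans ?_
    simp [take_snoc hkn, ← ih (by omega)]

theorem lintegral_next (h : IsAdaptiveSampling κ K) (hk : k < K)
    {g : (Fin k → E) → E → ℝ≥0∞} (hg : Measurable (Function.uncurry g)) :
    ∫⁻ D, g (Fin.take k hk.le D) (D ⟨k, hk⟩) ∂adaptiveLaw κ K =
      ∫⁻ D, ∫⁻ e, g (Fin.take k hk.le D) e ∂κ k (Fin.take k hk.le D) ∂adaptiveLaw κ K := by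
  have := h.isProbabilityMeasure k hk
  have hnext : Measurable fun D : Fin (k + 1) → E =>
      g (Fin.take k k.le_succ D) (D (Fin.last k)) :=
    hg.comp ((measurable_take _).prodMk (measurable_pi_apply _))
  calc ∫⁻ D, g (Fin.take k hk.le D) (D ⟨k, hk⟩) ∂adaptiveLaw κ K
      = ∫⁻ D, g (Fin.take k k.le_succ D) (D (Fin.last k)) ∂adaptiveLaw κ (k + 1) :=
        h.lintegral_take hnext hk le_rfl
    _ = ∫⁻ D, ∫⁻ e, g D e ∂κ k D ∂adaptiveLaw κ k := by
        simp only [h.lintegral_succ hk hnext, take_snoc le_rfl, Fin.snoc_last, Fin.take_eq_self]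
    _ = _ := (h.lintegral_take
        (measurable_lintegral_of_family (h.measurable k hk) hg) hk.le le_rfl).symm

theorem ae_forall_mem (h : IsAdaptiveSampling κ K) {s : Set E} (hs : MeasurableSet s)
    (hκ : ∀ k < K, ∀ D, ∀ᵐ e ∂κ k D, e ∈ s) :
    ∀ᵐ D ∂adaptiveLaw κ K, ∀ i, D i ∈ s := by
  refine ae_all_iff.2 fun i => ?_
  have hmeas : Measurable (sᶜ.indicator (1 : E → ℝ≥0∞)) := measurable_one.indicator hs.compl
  have hzero : ∫⁻ D, sᶜ.indicator 1 (D i) ∂adaptiveLaw κ K = 0 := by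
    rw [h.lintegral_next i.2 (g := fun _ => sᶜ.indicator 1) (hmeas.comp measurable_snd)]
    simp_rw [lintegral_indicator_one hs.compl,
      show ∀ D, κ i D sᶜ = 0 from fun D => hκ i i.2 D, lintegral_zero]
  filter_upwards [(lintegral_eq_zero_iff (hmeas.comp (measurable_pi_apply i))).1 hzero] with D hD
  simpa using hD

theorem lintegral_exp_predictableSum_le_one (h : IsAdaptiveSampling κ K)
    {w : (k : ℕ) → (Fin k → E) → E → ℝ} (hw : ∀ k < K, Measurable (Function.uncurry (w k)))
    (hexp : ∀ k < K, ∀ D, ∫⁻ e, ENNReal.ofReal (Real.exp (w k D e)) ∂κ k D ≤ 1) (hn : n ≤ K) :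
    ∫⁻ D, ENNReal.ofReal (Real.exp (predictableSum w D)) ∂adaptiveLaw κ n ≤ 1 := by
  induction n with
  | zero => simp [adaptiveLaw, predictableSum]
  | succ n ih =>
    have hmeas : Measurable fun D : Fin (n + 1) → E =>
        ENNReal.ofReal (Real.exp (predictableSum w D)) :=
      (measurable_predictableSum fun k hk => hw k (hk.trans_le hn)).exp.ennreal_ofReal
    rw [h.lintegral_succ hn hmeas]
    refine le_trans (lintegral_mono fun D => ?_) (ih (by omega))
    simp_rw [predictableSum_snoc, Real.exp_add, ENNReal.ofReal_mul (Real.exp_pos _).le]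
    rw [lintegral_const_mul' _ _ ENNReal.ofReal_ne_top]
    exact mul_le_of_le_one_right' (hexp n hn D)

theorem measure_le_predictableSum_le (h : IsAdaptiveSampling κ K)
    {w : (k : ℕ) → (Fin k → E) → E → ℝ} (hw : ∀ k < K, Measurable (Function.uncurry (w k)))
    (hexp : ∀ k < K, ∀ D, ∫⁻ e, ENNReal.ofReal (Real.exp (w k D e)) ∂κ k D ≤ 1) (θ : ℝ)
    (hn : n ≤ K) :
    adaptiveLaw κ K {D | θ ≤ predictableSum w (Fin.take n hn D)} ≤
      ENNReal.ofReal (Real.exp (-θ)) := by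
  have hmeas : Measurable fun D : Fin K → E => predictableSum w (Fin.take n hn D) :=
    (measurable_predictableSum fun k hk => hw k (hk.trans_le hn)).comp (measurable_take hn)
  have hle : ∫⁻ D, ENNReal.ofReal (Real.exp (predictableSum w (Fin.take n hn D)))
      ∂adaptiveLaw κ K ≤ 1 :=
    (h.lintegral_take (measurable_predictableSum fun k hk =>
      hw k (hk.trans_le hn)).exp.ennreal_ofReal hn le_rfl).trans_le
      (h.lintegral_exp_predictableSum_le_one hw hexp hn)
  calc adaptiveLaw κ K {D | θ ≤ predictableSum w (Fin.take n hn D)}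
      ≤ adaptiveLaw κ K {D | ENNReal.ofReal (Real.exp θ) ≤
          ENNReal.ofReal (Real.exp (predictableSum w (Fin.take n hn D)))} :=
        measure_mono fun D hD => ENNReal.ofReal_le_ofReal (Real.exp_le_exp.2 hD)
    _ ≤ 1 / ENNReal.ofReal (Real.exp θ) :=
        (meas_ge_le_lintegral_div hmeas.exp.ennreal_ofReal.aemeasurable
          (by simp [Real.exp_pos]) ENNReal.ofReal_ne_top).trans (ENNReal.div_le_div_right hle _)
    _ = ENNReal.ofReal (Real.exp (-θ)) := by
        rw [Real.exp_neg, ENNReal.ofReal_inv_of_pos (Real.exp_pos _), one_div]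

end IsAdaptiveSampling

end AdaptiveSampling

/-! ### Pigeonhole for the Eluder dimension -/

section EluderDimension

theorem exists_coloring_sum_le {ι : Type*} [LinearOrder ι] (s : Finset ι) (a : ι → ι → ℝ) {t : ℝ}
    {m : ℕ} [NeZero m] (hs : ∀ k ∈ s, ∑ i ∈ s with i < k, a k i ≤ m * t) :
    ∃ c : ι → Fin m, ∀ k ∈ s, ∑ i ∈ s with i < k ∧ c i = c k, a k i ≤ t := by
  induction s using Finset.induction_on_max with
  | empty => exact ⟨0, by simp⟩
  | insert k s hk ih =>
    have filter_insert {l : ι} (hl : l ≤ k) :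
        ({i ∈ insert k s | i < l} : Finset ι) = {i ∈ s | i < l} := by grind
    obtain ⟨c, hc⟩ := ih fun l hl => by
      simpa only [filter_insert (hk l hl).le] using hs l (Finset.mem_insert_of_mem hl)
    obtain ⟨j, -, hj⟩ : ∃ j ∈ (Finset.univ : Finset (Fin m)),
        ∑ i ∈ {i ∈ s | i < k} with c i = j, a k i ≤ t :=
      Finset.exists_sum_fiber_le_of_maps_to_of_sum_le_nsmul (fun _ _ => Finset.mem_univ _)
        Finset.univ_nonempty (by
          simpa [filter_insert le_rfl] using hs k (Finset.mem_insert_self k s))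
    refine ⟨Function.update c k j, fun l hl => ?_⟩
    rcases Finset.mem_insert.1 hl with rfl | hls
    · convert hj using 2
      grind
    · convert hc l hls using 2
      grind

variable {X : Type*} [MeasurableSpace X] {Φ : Set (X → ℝ)} {Λ : Set (Measure X)}
  {ι : Type*} [LinearOrder ι] {I : Finset ι} {μ : ι → Measure X} {φ : ι → X → ℝ} {ε t Γ : ℝ} {d : ℕ}

theorem card_le_of_dimDE_le (hd : dimDE Φ Λ ε ≤ d) (hεt : ε ≤ t) (ht : 0 ≤ t)
    (hμ : ∀ k ∈ I, μ k ∈ Λ) (hφ : ∀ k ∈ I, φ k ∈ Φ)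
    (hpast : ∀ k ∈ I, ∑ i ∈ I with i < k, (∫ x, φ k x ∂μ i) ^ 2 ≤ t ^ 2)
    (hlarge : ∀ k ∈ I, t < |∫ x, φ k x ∂μ k|) : I.card ≤ d := by
  let e := I.orderEmbOfFin rfl
  have he (i) : e i ∈ I := I.orderEmbOfFin_mem rfl i
  have hindep (i : Fin I.card) :
      IndepOf Φ t (μ (e i)) fun j : Fin i => μ (e (Fin.castLE i.isLt.le j)) := by
    refine ⟨φ (e i), hφ _ (he i), Real.sqrt_le_iff.2 ⟨ht, ?_⟩, hlarge _ (he i)⟩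
    let p : Fin i ↪ ι := ⟨_, e.injective.comp (Fin.castLE_injective i.isLt.le)⟩
    calc ∑ j, (∫ x, φ (e i) x ∂μ (p j)) ^ 2
        = ∑ l ∈ Finset.univ.map p, (∫ x, φ (e i) x ∂μ l) ^ 2 :=
          (Finset.sum_map _ p fun l => (∫ x, φ (e i) x ∂μ l) ^ 2).symm
      _ ≤ ∑ l ∈ I with l < e i, (∫ x, φ (e i) x ∂μ l) ^ 2 := by
        refine Finset.sum_le_sum_of_subset_of_nonneg (fun l hl => ?_) fun _ _ _ => sq_nonneg _
        obtain ⟨j, -, rfl⟩ := Finset.mem_map.1 hl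
        exact Finset.mem_filter.2 ⟨he _, e.strictMono (Fin.lt_def.2 j.2)⟩
      _ ≤ t ^ 2 := hpast _ (he i)
  have hle : (I.card : ℕ∞) ≤ dimDE Φ Λ ε :=
    le_iSup₂ (f := fun (n : ℕ) (_ : ∃ μ : Fin n → Measure X, (∀ i, μ i ∈ Λ) ∧
      ∃ ε' : ℝ, ε ≤ ε' ∧ ∀ i : Fin n, IndepOf Φ ε' (μ i)
        (fun j : Fin i => μ (Fin.castLE i.isLt.le j))) => (n : ℕ∞)) I.card
      ⟨fun i => μ (e i), fun i => hμ _ (he i), t, hεt, hindep⟩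
  exact_mod_cast hle.trans hd

theorem card_filter_lt_abs_integral_le (hd : dimDE Φ Λ ε ≤ d) (hεt : ε ≤ t) (ht : 0 < t)
    (hΓ : 0 ≤ Γ) (hμ : ∀ k ∈ I, μ k ∈ Λ) (hφ : ∀ k ∈ I, φ k ∈ Φ)
    (hpast : ∀ k ∈ I, ∑ i ∈ I with i < k, (∫ x, φ k x ∂μ i) ^ 2 ≤ Γ) :
    (Finset.card {k ∈ I | t < |∫ x, φ k x ∂μ k|} : ℝ) ≤ (Γ / t ^ 2 + 1) * d := by
  set J : Finset ι := {k ∈ I | t < |∫ x, φ k x ∂μ k|}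
  have hJ : J ⊆ I := Finset.filter_subset _ _
  set m := ⌊Γ / t ^ 2⌋₊ + 1 with hm
  have hΓm : Γ ≤ m * t ^ 2 := by
    rw [← div_le_iff₀ (by positivity)]
    exact_mod_cast (Nat.lt_floor_add_one _).le
  obtain ⟨c, hc⟩ := exists_coloring_sum_le J (fun k i => (∫ x, φ k x ∂μ i) ^ 2) (m := m)
    (t := t ^ 2) fun k hk => ((Finset.sum_le_sum_of_subset_of_nonneg
      (Finset.filter_subset_filter _ hJ) fun _ _ _ => sq_nonneg _).trans
      (hpast k (hJ hk))).trans hΓm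
  have hclass (j : Fin m) : Finset.card {k ∈ J | c k = j} ≤ d := by
    refine card_le_of_dimDE_le hd hεt ht.le (μ := μ) (φ := φ) (fun k hk => hμ k ?_)
      (fun k hk => hφ k ?_) (fun k hk => ?_) fun k hk => ?_
    · grind
    · grind
    · convert hc k (Finset.mem_filter.1 hk).1 using 2
      grind
    · grind
  have hcard : J.card ≤ m * d := by
    rw [Finset.card_eq_sum_card_fiberwise (f := c) (t := Finset.univ) fun _ _ => by simp]
    simpa using Finset.sum_le_card_nsmul Finset.univ _ d fun j _ => hclass j
  calc (J.card : ℝ) ≤ m * d := by exact_mod_cast hcard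
    _ ≤ (Γ / t ^ 2 + 1) * d := by
      rw [hm, Nat.cast_add_one]
      gcongr
      exact Nat.floor_le (by positivity)

end EluderDimension

section LayerCake

theorem sub_le_integral_indicator_Iio {t c b : ℝ} (ht : t ≤ c) (hb : b ≤ c) :
    b - t ≤ ∫ u in t..c, (Set.Iio b).indicator 1 u := by
  rw [intervalIntegral.integral_of_le ht, setIntegral_indicator measurableSet_Iio]
  simp only [Pi.one_apply, setIntegral_const, smul_eq_mul, mul_one]
  calc b - t ≤ volume.real (Set.Ioo t b) := by simp [Real.volume_real_Ioo]
    _ ≤ volume.real (Set.Ioc t c ∩ Set.Iio b) :=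
      measureReal_mono (fun u hu => ⟨⟨hu.1, hu.2.le.trans hb⟩, hu.2⟩)
        (measure_ne_top_of_subset Set.inter_subset_left (by simp))

variable {ι : Type*} {s : Finset ι} {b : ι → ℝ} {ω Γ d : ℝ}

theorem integral_div_sq_add_one_mul {t : ℝ} (ht : 0 < t) (ht1 : t ≤ 1) :
    IntervalIntegrable (fun u => (Γ / u ^ 2 + 1) * d) volume t 1 ∧
      ∫ u in t..1, (Γ / u ^ 2 + 1) * d = (Γ / t - Γ + 1 - t) * d := by
  have hpos {u : ℝ} (hu : u ∈ Set.uIcc t 1) : u ≠ 0 :=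
    (ht.trans_le (Set.uIcc_of_le ht1 ▸ hu).1).ne'
  have hintegrable : IntervalIntegrable (fun u => (Γ / u ^ 2 + 1) * d) volume t 1 :=
    ContinuousOn.intervalIntegrable <|
      ((continuousOn_const.div (by fun_prop) fun u hu => pow_ne_zero 2 (hpos hu)).add
        continuousOn_const).mul continuousOn_const
  refine ⟨hintegrable, (intervalIntegral.integral_eq_sub_of_hasDerivAt
    (f := fun u => (-Γ * u⁻¹ + u) * d) (fun u hu => ?_) hintegrable).trans ?_⟩
  · refine ((((hasDerivAt_inv (hpos hu)).const_mul (-Γ)).add (hasDerivAt_id u)).mul_const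
      d).congr_deriv ?_
    ring
  · ring

theorem sum_le_threshold_of_card_filter_lt_le {t : ℝ} (ht : 0 < t) (hΓ : 0 ≤ Γ) (hd : 0 ≤ d)
    (hb : ∀ k ∈ s, b k ≤ 1)
    (hcard : ∀ u, t ≤ u → (Finset.card {k ∈ s | u < b k} : ℝ) ≤ (Γ / u ^ 2 + 1) * d) :
    ∑ k ∈ s, b k ≤ t * s.card + Γ * d / t + d := by
  have hrest : 0 ≤ Γ * d / t := by positivity
  rcases le_total 1 t with ht1 | ht1
  · have hsum : ∑ k ∈ s, b k ≤ s.card := by simpa using Finset.sum_le_card_nsmul s b 1 hb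
    nlinarith [(Nat.cast_nonneg s.card : (0 : ℝ) ≤ s.card)]
  obtain ⟨hintegrable, hintegral⟩ := integral_div_sq_add_one_mul (Γ := Γ) (d := d) ht ht1
  have hindicator (k : ι) :
      IntervalIntegrable ((Set.Iio (b k)).indicator (1 : ℝ → ℝ)) volume t 1 :=
    (intervalIntegrable_iff_integrableOn_Ioc_of_le ht1).2
      ((integrableOn_const (by simp)).indicator measurableSet_Iio)
  have hexcess : ∑ k ∈ s, (b k - t) ≤ (Γ / t - Γ + 1 - t) * d := by
    calc ∑ k ∈ s, (b k - t)
        ≤ ∑ k ∈ s, ∫ u in t..1, (Set.Iio (b k)).indicator 1 u :=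
          Finset.sum_le_sum fun k hk => sub_le_integral_indicator_Iio ht1 (hb k hk)
      _ = ∫ u in t..1, ∑ k ∈ s, (Set.Iio (b k)).indicator 1 u :=
          (intervalIntegral.integral_finsetSum fun k _ => hindicator k).symm
      _ ≤ ∫ u in t..1, (Γ / u ^ 2 + 1) * d := by
          refine intervalIntegral.integral_mono_on ht1 ?_ hintegrable fun u hu => ?_
          · simpa only [Finset.sum_fn] using IntervalIntegrable.sum s fun k _ => hindicator k
          · simpa [Set.indicator_apply] using hcard u hu.1
      _ = (Γ / t - Γ + 1 - t) * d := hintegral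
  rw [Finset.sum_sub_distrib, Finset.sum_const, nsmul_eq_mul] at hexcess
  have : (Γ / t - Γ + 1 - t) * d = Γ * d / t + d - (Γ + t) * d := by ring
  nlinarith [mul_nonneg (add_nonneg hΓ ht.le) hd]

theorem sum_le_of_card_filter_lt_le (hω : 0 < ω) (hΓ : 0 ≤ Γ) (hd : 0 ≤ d)
    (hb : ∀ k ∈ s, b k ≤ 1)
    (hcard : ∀ u, ω ≤ u → (Finset.card {k ∈ s | u < b k} : ℝ) ≤ (Γ / u ^ 2 + 1) * d) :
    ∑ k ∈ s, b k ≤ ω * s.card + d + 2 * √(d * Γ * s.card) := by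
  rcases s.eq_empty_or_nonempty with rfl | hs
  · simpa using hd
  have hn : (0 : ℝ) < s.card := by exact_mod_cast hs.card_pos
  set n : ℝ := (s.card : ℝ)
  set q := √(d * Γ / n)
  have hq : Γ * d = n * q ^ 2 := by rw [Real.sq_sqrt (by positivity)]; field_simp
  have hnq : √(d * Γ * n) = n * q := by
    rw [← Real.sqrt_sq (by positivity : 0 ≤ n * q), mul_pow, Real.sq_sqrt (by positivity)]
    field_simp
  have hmax : 0 < max ω q := hω.trans_le (le_max_left _ _)
  calc ∑ k ∈ s, b k ≤ max ω q * n + Γ * d / max ω q + d :=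
        sum_le_threshold_of_card_filter_lt_le hmax hΓ hd hb fun u hu =>
          hcard u ((le_max_left _ _).trans hu)
    _ ≤ (ω + q) * n + n * q + d := by
      gcongr
      · exact max_le_add_of_nonneg hω.le (Real.sqrt_nonneg _)
      · rw [div_le_iff₀ hmax, hq, sq, ← mul_assoc]
        gcongr
        exact le_max_right _ _
    _ = ω * n + d + 2 * √(d * Γ * n) := by rw [hnq]; ring

end LayerCake

theorem sum_abs_integral_le_of_dimDE_le {X : Type*} [MeasurableSpace X] {Φ : Set (X → ℝ)}
    {Λ : Set (Measure X)} {ι : Type*} [LinearOrder ι] {I : Finset ι} {μ : ι → Measure X}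
    {φ : ι → X → ℝ} {ε Γ : ℝ} {d : ℕ} (hd : dimDE Φ Λ ε ≤ d) (hε : 0 < ε) (hΓ : 0 ≤ Γ)
    (hμ : ∀ k ∈ I, μ k ∈ Λ) (hφ : ∀ k ∈ I, φ k ∈ Φ)
    (hpast : ∀ k ∈ I, ∑ i ∈ I with i < k, (∫ x, φ k x ∂μ i) ^ 2 ≤ Γ)
    (hone : ∀ k ∈ I, |∫ x, φ k x ∂μ k| ≤ 1) :
    ∑ k ∈ I, |∫ x, φ k x ∂μ k| ≤ ε * I.card + d + 2 * √(d * Γ * I.card) :=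
  sum_le_of_card_filter_lt_le hε hΓ d.cast_nonneg hone fun _ ht =>
    card_filter_lt_abs_integral_le hd ht (hε.trans_le ht) hΓ hμ hφ hpast

/-! ### Laws of states, tuples and epochs -/

/-- Measurable functions `S × A → [0, 1]` (curried): the members of a value class. -/
structure UnitValued {S A : Type*} [MeasurableSpace S] [MeasurableSpace A] (g : S → A → ℝ) :
    Prop where
  measurable : Measurable (Function.uncurry g)
  mem_Icc : ∀ s a, g s a ∈ Set.Icc (0 : ℝ) 1

section ActionMax

variable {S A : Type*}

/-- The value `max_a g(s, a)` of a state under an action-value function. -/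
def actionMax (g : S → A → ℝ) (s : S) : ℝ := ⨆ a, g s a

section Order

variable [Finite A] {g g' : S → A → ℝ} {s : S}

theorem le_actionMax (g : S → A → ℝ) (s : S) (a : A) : g s a ≤ actionMax g s :=
  le_ciSup (Set.finite_range (g s)).bddAbove a

variable [Nonempty A]

theorem actionMax_eq {a : A} (h : ∀ a', g s a' ≤ g s a) : actionMax g s = g s a :=
  le_antisymm (ciSup_le h) (le_actionMax g s a)

theorem abs_actionMax_sub_le {ρ : ℝ} (h : ∀ a, |g s a - g' s a| ≤ ρ) :
    |actionMax g s - actionMax g' s| ≤ ρ := by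
  refine abs_sub_le_iff.2 ⟨sub_le_iff_le_add'.2 (ciSup_le fun a => ?_),
    sub_le_iff_le_add'.2 (ciSup_le fun a => ?_)⟩
  · linarith [(abs_le.1 (h a)).2, le_actionMax g' s a]
  · linarith [(abs_le.1 (h a)).1, le_actionMax g s a]

end Order

variable [MeasurableSpace S] [MeasurableSpace A] {g : S → A → ℝ}

protected theorem UnitValued.zero : UnitValued (0 : S → A → ℝ) :=
  ⟨measurable_const, fun _ _ => by simp⟩

variable [Finite A]

theorem measurable_actionMax_uncurry {Ω : Type*} [MeasurableSpace Ω] {g : Ω → S → A → ℝ}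
    (hg : Measurable fun p : Ω × S × A => g p.1 p.2.1 p.2.2) :
    Measurable (Function.uncurry fun ω => actionMax (g ω)) :=
  Measurable.iSup fun _ => hg.comp (measurable_fst.prodMk (measurable_snd.prodMk measurable_const))

namespace UnitValued

theorem measurable_actionMax (hg : UnitValued g) : Measurable (actionMax g) :=
  Measurable.iSup fun _ => hg.measurable.comp (measurable_id.prodMk measurable_const)

variable [Nonempty A]

theorem actionMax_mem_Icc (hg : UnitValued g) (s : S) : actionMax g s ∈ Set.Icc (0 : ℝ) 1 :=
  ⟨(hg.mem_Icc s (Classical.arbitrary A)).1.trans (le_actionMax g s _),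
    ciSup_le fun a => (hg.mem_Icc s a).2⟩

theorem integrable_actionMax (hg : UnitValued g) (μ : Measure S) [IsFiniteMeasure μ] :
    Integrable (actionMax g) μ :=
  .of_mem_Icc 0 1 hg.measurable_actionMax.aemeasurable (.of_forall hg.actionMax_mem_Icc)

theorem integral_actionMax_mem_Icc (hg : UnitValued g) (μ : Measure S) [IsProbabilityMeasure μ] :
    ∫ s, actionMax g s ∂μ ∈ Set.Icc (0 : ℝ) 1 :=
  (convex_Icc 0 1).integral_mem isClosed_Icc (.of_forall hg.actionMax_mem_Icc)
    (hg.integrable_actionMax μ)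

end UnitValued

end ActionMax

namespace MDP

variable {S A : Type*} [MeasurableSpace S] [MeasurableSpace A] (M : MDP S A)

instance isMarkovKernel_P (h : ℕ) : IsMarkovKernel (M.P h) := M.markov h

section StateLaw

variable {π : ℕ → S → A} {h n : ℕ} (s : S)

theorem isProbabilityMeasure_stateLaw (hπ : ∀ m < n, Measurable (π (h + m))) :
    IsProbabilityMeasure (M.stateLaw π h s n) := by
  induction n with
  | zero => rw [stateLaw]; infer_instance
  | succ n ih =>
    have := ih fun m hm => hπ m (by omega)
    exact isProbabilityMeasure_bind ((M.P (h + n)).measurable.comp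
      (measurable_id.prodMk (hπ n n.lt_succ_self))).aemeasurable (.of_forall fun _ => inferInstance)

theorem measurable_stateLaw {Ω : Type*} [MeasurableSpace Ω] {π : Ω → ℕ → S → A}
    (hπ : ∀ m < n, Measurable (Function.uncurry fun ω => π ω (h + m))) :
    Measurable fun ω => M.stateLaw (π ω) h s n := by
  induction n with
  | zero => exact measurable_const
  | succ n ih =>
    have (ω : Ω) := M.isProbabilityMeasure_stateLaw s (π := π ω) (h := h) (n := n)
      fun m hm => (hπ m (by omega)).of_uncurry_left
    exact measurable_bind_of_family (ih fun m hm => hπ m (by omega))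
      ((M.P (h + n)).measurable.comp (measurable_snd.prodMk (hπ n n.lt_succ_self)))

theorem integral_stateLaw_succ (hπ : ∀ m ≤ n, Measurable (π (h + m))) {u : S → ℝ}
    (hu : Measurable u) {b : ℝ} (hb : ∀ s, |u s| ≤ b) :
    ∫ s', u s' ∂M.stateLaw π h s (n + 1) =
      ∫ s', ∫ s'', u s'' ∂M.P (h + n) (s', π (h + n) s') ∂M.stateLaw π h s n := by
  let κ : Kernel S S := (M.P (h + n)).comap (fun s' => (s', π (h + n) s'))
    (measurable_id.prodMk (hπ n le_rfl))
  have := M.isProbabilityMeasure_stateLaw s (n := n) fun m hm => hπ m hm.le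
  have := M.isProbabilityMeasure_stateLaw s (n := n + 1) fun m hm => hπ m (by omega)
  exact Kernel.integral_comp (κ := Kernel.const Unit (M.stateLaw π h s n)) (η := κ) (a := ())
    (Integrable.of_bound (μ := M.stateLaw π h s (n + 1)) hu.aestronglyMeasurable b (.of_forall hb))

end StateLaw

section ObservationLaw

variable {h : ℕ}

/-- Law of the tuple observed at step `h` from state `s`, after a uniformly random action. -/
def observationLaw (h : ℕ) (s : S) : Measure (S × A × ℝ × S) :=
  (uniformOn (Set.univ : Set A)).bind fun a =>
    (M.P h (s, a)).map fun s' => (s, a, M.r h s a, s')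

theorem measurable_observation (h : ℕ) (s : S) (a : A) :
    Measurable fun s' : S => (s, a, M.r h s a, s') :=
  measurable_const.prodMk (measurable_const.prodMk (measurable_const.prodMk measurable_id))

theorem measurable_observationLaw [Finite A] [Nonempty A] : Measurable (M.observationLaw h) := by
  refine measurable_bind_of_family measurable_const
    (η := fun s a => (M.P h (s, a)).map fun s' => (s, a, M.r h s a, s')) ?_
  refine measurable_map_of_family (M.P h).measurable
    (g := fun (p : S × A) s' => (p.1, p.2, M.r h p.1 p.2, s')) ?_
  exact measurable_fst.fst.prodMk (measurable_fst.snd.prodMk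
    (((M.r_measurable h).comp measurable_fst).prodMk measurable_snd))

variable [MeasurableSingletonClass A]

theorem measurable_map_observation [Finite A] (h : ℕ) (s : S) :
    Measurable fun a : A => (M.P h (s, a)).map fun s' => (s, a, M.r h s a, s') :=
  measurable_of_finite _

theorem lintegral_observationLaw [Fintype A] (s : S) {F : S × A × ℝ × S → ℝ≥0∞}
    (hF : Measurable F) :
    ∫⁻ z, F z ∂M.observationLaw h s =
      (Fintype.card A : ℝ≥0∞)⁻¹ * ∑ a, ∫⁻ s', F (s, a, M.r h s a, s') ∂M.P h (s, a) := by
  rw [observationLaw, Measure.lintegral_bind (M.measurable_map_observation h s).aemeasurable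
    hF.aemeasurable, lintegral_uniformOn_univ]
  simp_rw [lintegral_map hF (M.measurable_observation h s _)]

theorem lintegral_observationLaw_fst_mul [Finite A] (s : S) {g : S → ℝ≥0∞} (hg : Measurable g)
    {F : S × A × ℝ × S → ℝ≥0∞} (hF : Measurable F) :
    ∫⁻ z, g z.1 * F z ∂M.observationLaw h s = g s * ∫⁻ z, F z ∂M.observationLaw h s := by
  have := Fintype.ofFinite A
  have hFa (a : A) : Measurable fun s' => F (s, a, M.r h s a, s') :=
    hF.comp (M.measurable_observation h s a)
  refine (M.lintegral_observationLaw s ((hg.comp measurable_fst).mul hF)).trans ?_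
  rw [M.lintegral_observationLaw s hF]
  simp only [Pi.mul_apply, Function.comp_apply]
  simp_rw [lintegral_const_mul _ (hFa _)]
  rw [← Finset.mul_sum, mul_left_comm]

variable [Finite A] [Nonempty A]

instance isProbabilityMeasure_observationLaw (s : S) :
    IsProbabilityMeasure (M.observationLaw h s) :=
  isProbabilityMeasure_bind (M.measurable_map_observation h s).aemeasurable
    (.of_forall fun a => Measure.isProbabilityMeasure_map
      (M.measurable_observation h s a).aemeasurable)

end ObservationLaw

section TupleLaw

variable [Finite A] [Nonempty A] {π : ℕ → S → A} {h : ℕ}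

theorem lintegral_tupleLaw {F : S × A × ℝ × S → ℝ≥0∞} (hF : Measurable F) :
    ∫⁻ z, F z ∂M.tupleLaw π h =
      ∫⁻ s, ∫⁻ z, F z ∂M.observationLaw h s ∂M.stateLaw π 0 M.s₁ h :=
  Measure.lintegral_bind M.measurable_observationLaw.aemeasurable hF.aemeasurable

theorem measurable_tupleLaw {Ω : Type*} [MeasurableSpace Ω] {π : Ω → ℕ → S → A}
    (hπ : ∀ m < h, Measurable (Function.uncurry fun ω => π ω m)) :
    Measurable fun ω => M.tupleLaw (π ω) h := by
  have (ω : Ω) := M.isProbabilityMeasure_stateLaw (π := π ω) (h := 0) M.s₁ (n := h)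
    fun m hm => by simpa using (hπ m hm).of_uncurry_left
  exact measurable_bind_of_family (M.measurable_stateLaw (h := 0) M.s₁ (by simpa using hπ))
    (M.measurable_observationLaw.comp measurable_snd)

variable [MeasurableSingletonClass A]

theorem lintegral_tupleLaw_fst {g : S → ℝ≥0∞} (hg : Measurable g) :
    ∫⁻ z, g z.1 ∂M.tupleLaw π h = ∫⁻ s, g s ∂M.stateLaw π 0 M.s₁ h := by
  refine (M.lintegral_tupleLaw (hg.comp measurable_fst)).trans (lintegral_congr fun s => ?_)
  simpa using M.lintegral_observationLaw_fst_mul (h := h) s hg measurable_one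

theorem isProbabilityMeasure_tupleLaw (hπ : ∀ m < h, Measurable (π m)) :
    IsProbabilityMeasure (M.tupleLaw π h) :=
  have := M.isProbabilityMeasure_stateLaw (π := π) (h := 0) M.s₁ (n := h) (by simpa using hπ)
  isProbabilityMeasure_bind M.measurable_observationLaw.aemeasurable
    (.of_forall M.isProbabilityMeasure_observationLaw)

theorem isProbabilityMeasure_epochLaw (hπ : ∀ m < M.H, Measurable (π m)) :
    IsProbabilityMeasure (M.epochLaw π) := by
  have (h : Fin M.H) := M.isProbabilityMeasure_tupleLaw (h := h) fun m hm => hπ m (hm.trans h.2)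
  unfold epochLaw
  infer_instance

theorem lintegral_epochLaw_eval (hπ : ∀ m < M.H, Measurable (π m)) (h : Fin M.H)
    {F : S × A × ℝ × S → ℝ≥0∞} (hF : Measurable F) :
    ∫⁻ e, F (e h) ∂M.epochLaw π = ∫⁻ z, F z ∂M.tupleLaw π h :=
  have (h : Fin M.H) := M.isProbabilityMeasure_tupleLaw (h := h) fun m hm => hπ m (hm.trans h.2)
  (measurePreserving_eval (fun h : Fin M.H => M.tupleLaw π h) h).lintegral_comp hF

theorem measurable_epochLaw {Ω : Type*} [MeasurableSpace Ω] {π : Ω → ℕ → S → A}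
    (hπ : ∀ m < M.H, Measurable (Function.uncurry fun ω => π ω m)) :
    Measurable fun ω => M.epochLaw (π ω) := by
  have (ω : Ω) (h : Fin M.H) := M.isProbabilityMeasure_tupleLaw (π := π ω) (h := h)
    fun m hm => (hπ m (hm.trans h.2)).of_uncurry_left
  exact measurable_pi_of_family fun h => M.measurable_tupleLaw fun m hm => hπ m (hm.trans h.2)

end TupleLaw

end MDP

/-! ### Excess loss and its exponential moment -/

section ExponentialMoment

variable {e η : ℝ}

theorem exp_neg_sq_add_mul_le (he : |e| ≤ 2) (hη : |η| ≤ 1) :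
    Real.exp (-((e ^ 2 + 2 * e * η) / 8)) ≤
      Real.exp (-(e ^ 2 / 8)) * (1 + e ^ 2 / 16 - e / 4 * η) := by
  have hsmall : |-(e / 4 * η)| ≤ 1 := by
    rw [abs_neg, abs_mul, abs_div, abs_of_pos (four_pos : (0 : ℝ) < 4)]
    nlinarith [abs_nonneg e, abs_nonneg η]
  have hexp := (abs_le.1 (Real.abs_exp_sub_one_sub_id_le hsmall)).2
  have hη2 : η ^ 2 ≤ 1 := (sq_le_one_iff_abs_le_one η).2 hη
  rw [show -((e ^ 2 + 2 * e * η) / 8) = -(e ^ 2 / 8) + -(e / 4 * η) by ring, Real.exp_add]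
  gcongr
  nlinarith [mul_nonneg (sq_nonneg e) (sub_nonneg.2 hη2)]

theorem exp_neg_sq_mul_one_add_sq_le (he : |e| ≤ 2) :
    Real.exp (-(e ^ 2 / 8)) * (1 + e ^ 2 / 16) ≤ 1 - e ^ 2 / 32 := by
  have he2 : e ^ 2 ≤ 4 := by nlinarith [abs_le.1 he]
  have hsmall : |-(e ^ 2 / 16)| ≤ 1 := by
    rw [abs_neg, abs_of_nonneg (by positivity)]; linarith
  calc Real.exp (-(e ^ 2 / 8)) * (1 + e ^ 2 / 16)
      ≤ Real.exp (-(e ^ 2 / 8)) * Real.exp (e ^ 2 / 16) := by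
        gcongr; linarith [Real.add_one_le_exp (e ^ 2 / 16)]
    _ = Real.exp (-(e ^ 2 / 16)) := by rw [← Real.exp_add]; ring_nf
    _ ≤ 1 - e ^ 2 / 32 := by
        nlinarith [(abs_le.1 (Real.abs_exp_sub_one_sub_id_le hsmall)).2]

variable {Ω : Type*} [MeasurableSpace Ω] {μ : Measure Ω} [IsProbabilityMeasure μ]

theorem lintegral_exp_neg_sq_sub_sq_le {X : Ω → ℝ} (hX : Measurable X)
    (hX01 : ∀ ω, X ω ∈ Set.Icc (0 : ℝ) 1) {x : ℝ} (hx : |x - μ[X]| ≤ 2) :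
    ∫⁻ ω, ENNReal.ofReal (Real.exp (-(((x - X ω) ^ 2 - (μ[X] - X ω) ^ 2) / 8))) ∂μ ≤
      ENNReal.ofReal (1 - (x - μ[X]) ^ 2 / 32) := by
  set v := μ[X]
  set e := x - v
  have hi : Integrable X μ := .of_mem_Icc 0 1 hX.aemeasurable (.of_forall hX01)
  have hv : v ∈ Set.Icc (0 : ℝ) 1 :=
    (convex_Icc 0 1).integral_mem isClosed_Icc (.of_forall hX01) hi
  have hpointwise (ω : Ω) : Real.exp (-(((x - X ω) ^ 2 - (v - X ω) ^ 2) / 8)) ≤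
      Real.exp (-(e ^ 2 / 8)) * (1 + e ^ 2 / 16 - e / 4 * (v - X ω)) := by
    rw [show (x - X ω) ^ 2 - (v - X ω) ^ 2 = e ^ 2 + 2 * e * (v - X ω) by simp only [e]; ring]
    exact exp_neg_sq_add_mul_le hx
      (abs_le.2 ⟨by linarith [hv.1, (hX01 ω).2], by linarith [hv.2, (hX01 ω).1]⟩)
  have hi' : Integrable (fun ω => e / 4 * (v - X ω)) μ := ((integrable_const v).sub hi).const_mul _
  have hbound : Integrable (fun ω => Real.exp (-(e ^ 2 / 8)) *
      (1 + e ^ 2 / 16 - e / 4 * (v - X ω))) μ := ((integrable_const _).sub hi').const_mul _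
  have hcentred : ∫ ω, e / 4 * (v - X ω) ∂μ = 0 := by
    simp [integral_const_mul, integral_sub (integrable_const v) hi, v]
  calc _ ≤ ∫⁻ ω, ENNReal.ofReal
        (Real.exp (-(e ^ 2 / 8)) * (1 + e ^ 2 / 16 - e / 4 * (v - X ω))) ∂μ :=
        lintegral_mono fun ω => ENNReal.ofReal_le_ofReal (hpointwise ω)
    _ = ENNReal.ofReal (Real.exp (-(e ^ 2 / 8)) * (1 + e ^ 2 / 16)) := by
        rw [← ofReal_integral_eq_lintegral_ofReal hbound
          (.of_forall fun ω => (Real.exp_pos _).le.trans (hpointwise ω)), integral_const_mul,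
          integral_sub (integrable_const _) hi', hcentred]
        simp
    _ ≤ ENNReal.ofReal (1 - e ^ 2 / 32) :=
        ENNReal.ofReal_le_ofReal (exp_neg_sq_mul_one_add_sq_le hx)

theorem ofReal_exp_mul_ofReal_one_sub_le (x : ℝ) :
    ENNReal.ofReal (Real.exp x) * ENNReal.ofReal (1 - x) ≤ 1 := by
  rw [← ENNReal.ofReal_mul (Real.exp_pos _).le, ENNReal.ofReal_le_one]
  calc Real.exp x * (1 - x) ≤ Real.exp x * Real.exp (-x) := by
        gcongr; exact Real.one_sub_le_exp_neg x
    _ = 1 := by rw [← Real.exp_add, add_neg_cancel, Real.exp_zero]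

theorem ofReal_exp_integral_mul_lintegral_one_sub_le {q : Ω → ℝ} (hq : Integrable q μ)
    (hq1 : ∀ ω, q ω ≤ 1) :
    ENNReal.ofReal (Real.exp (∫ ω, q ω ∂μ)) * ∫⁻ ω, ENNReal.ofReal (1 - q ω) ∂μ ≤ 1 := by
  have hi : Integrable (fun ω => 1 - q ω) μ := (integrable_const 1).sub hq
  rw [← ofReal_integral_eq_lintegral_ofReal hi (.of_forall fun ω => sub_nonneg.2 (hq1 ω)),
    integral_sub (integrable_const 1) hq]
  simpa using ofReal_exp_mul_ofReal_one_sub_le (∫ ω, q ω ∂μ)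

end ExponentialMoment

namespace MDP

variable {S A : Type*} [MeasurableSpace S] [MeasurableSpace A]

section Bellman

variable {M : MDP S A} {h : ℕ} {ξ ζ ζ' : S → A → ℝ}

theorem bellman_eq (M : MDP S A) (h : ℕ) (g : S → A → ℝ) (s : S) (a : A) :
    M.bellman h g s a = M.r h s a + ∫ s', actionMax g s' ∂M.P h (s, a) := rfl

variable [Finite A]

theorem measurable_bellman_uncurry {Ω : Type*} [MeasurableSpace Ω] {g : Ω → S → A → ℝ}
    (hg : Measurable fun p : Ω × S × A => g p.1 p.2.1 p.2.2) :
    Measurable fun p : Ω × S × A => M.bellman h (g p.1) p.2.1 p.2.2 := by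
  refine ((M.r_measurable h).comp measurable_snd).add ?_
  exact measurable_integral_of_family (κ := fun p : Ω × S × A => M.P h p.2)
    (g := fun p => actionMax (g p.1)) ((M.P h).measurable.comp measurable_snd)
    ((measurable_actionMax_uncurry hg).comp (measurable_fst.fst.prodMk measurable_snd))

theorem measurable_bellman (hζ : UnitValued ζ) : Measurable (Function.uncurry (M.bellman h ζ)) :=
  (measurable_bellman_uncurry (Ω := Unit) (g := fun _ => ζ)
    (hζ.measurable.comp measurable_snd)).comp (measurable_prodMk_left (x := ()))

variable [Nonempty A]

theorem abs_bellman_sub_le (hζ : UnitValued ζ) (hζ' : UnitValued ζ') {ρ : ℝ}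
    (hρ : ∀ s a, |ζ s a - ζ' s a| ≤ ρ) (s : S) (a : A) :
    |M.bellman h ζ s a - M.bellman h ζ' s a| ≤ ρ := by
  rw [bellman_eq, bellman_eq, add_sub_add_left_eq_sub,
    ← integral_sub (hζ.integrable_actionMax _) (hζ'.integrable_actionMax _)]
  simpa using norm_integral_le_of_norm_le_const (μ := M.P h (s, a))
    (f := fun s' => actionMax ζ s' - actionMax ζ' s')
    (.of_forall fun s' => abs_actionMax_sub_le (hρ s'))

theorem bellman_mem_Icc (hr : ∀ s a, M.r h s a ≤ 1) (hζ : UnitValued ζ) (s : S) (a : A) :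
    M.bellman h ζ s a ∈ Set.Icc (0 : ℝ) 2 := by
  have hmax := hζ.integral_actionMax_mem_Icc (M.P h (s, a))
  rw [bellman_eq]
  exact ⟨add_nonneg (M.r_nonneg h s a) hmax.1, by linarith [hr s a, hmax.2]⟩

theorem abs_sub_bellman_le (hr : ∀ s a, M.r h s a ≤ 1) (hξ : UnitValued ξ) (hζ : UnitValued ζ)
    (s : S) (a : A) : |ξ s a - M.bellman h ζ s a| ≤ 2 := by
  have hb := bellman_mem_Icc hr hζ s a
  have hx := hξ.mem_Icc s a
  exact abs_le.2 ⟨by linarith [hb.2, hx.1], by linarith [hb.1, hx.2]⟩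

end Bellman

section ExcessLoss

/-- Squared loss of `ξ` minus squared loss of the Bellman backup of `ζ`, for targets built from `ζ`,
at one observed tuple. -/
def excessLoss (M : MDP S A) (h : ℕ) (ξ ζ : S → A → ℝ) (z : S × A × ℝ × S) : ℝ :=
  (ξ z.1 z.2.1 - z.2.2.1 - actionMax ζ z.2.2.2) ^ 2 -
    (M.bellman h ζ z.1 z.2.1 - z.2.2.1 - actionMax ζ z.2.2.2) ^ 2

/-- Squared Bellman residual of `ξ` against the backup of `ζ`, averaged over the actions. -/
def meanSqResidual [Fintype A] (M : MDP S A) (h : ℕ) (ξ ζ : S → A → ℝ) (s : S) : ℝ :=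
  (Fintype.card A : ℝ)⁻¹ * ∑ a, (ξ s a - M.bellman h ζ s a) ^ 2

variable {M : MDP S A} {h : ℕ} {ξ ζ : S → A → ℝ}

theorem measurable_excessLoss [Finite A] (hξ : UnitValued ξ) (hζ : UnitValued ζ) :
    Measurable (M.excessLoss h ξ ζ) := by
  have hsa : Measurable fun z : S × A × ℝ × S => (z.1, z.2.1) :=
    measurable_fst.prodMk measurable_snd.fst
  have hmax : Measurable fun z : S × A × ℝ × S => actionMax ζ z.2.2.2 :=
    hζ.measurable_actionMax.comp measurable_snd.snd.snd
  exact ((((hξ.measurable.comp hsa).sub measurable_snd.snd.fst).sub hmax).pow_const 2).sub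
    (((((measurable_bellman hζ).comp hsa).sub measurable_snd.snd.fst).sub hmax).pow_const 2)

theorem lintegral_exp_neg_excessLoss_le [Finite A] [Nonempty A] (hr : ∀ s a, M.r h s a ≤ 1)
    (hξ : UnitValued ξ) (hζ : UnitValued ζ) (s : S) (a : A) :
    ∫⁻ s', ENNReal.ofReal (Real.exp (-(M.excessLoss h ξ ζ (s, a, M.r h s a, s') / 8)))
      ∂M.P h (s, a) ≤ ENNReal.ofReal (1 - (ξ s a - M.bellman h ζ s a) ^ 2 / 32) := by
  have hx := abs_sub_bellman_le hr hξ hζ s a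
  simp only [excessLoss, bellman_eq, add_sub_cancel_left] at hx ⊢
  rw [← sub_sub] at hx ⊢
  exact lintegral_exp_neg_sq_sub_sq_le hζ.measurable_actionMax hζ.actionMax_mem_Icc hx

variable [Fintype A]

theorem measurable_meanSqResidual (hξ : UnitValued ξ) (hζ : UnitValued ζ) :
    Measurable (M.meanSqResidual h ξ ζ) :=
  (Finset.measurable_sum _ fun _ _ =>
    ((hξ.measurable.comp (measurable_id.prodMk measurable_const)).sub
      ((measurable_bellman hζ).comp (measurable_id.prodMk measurable_const))).pow_const
        2).const_mul _

variable [Nonempty A]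

theorem meanSqResidual_mem_Icc (hr : ∀ s a, M.r h s a ≤ 1) (hξ : UnitValued ξ)
    (hζ : UnitValued ζ) (s : S) : M.meanSqResidual h ξ ζ s ∈ Set.Icc (0 : ℝ) 4 := by
  have hcard : (0 : ℝ) < Fintype.card A := by exact_mod_cast Fintype.card_pos
  refine ⟨by unfold meanSqResidual; positivity, (inv_mul_le_iff₀ hcard).2 ?_⟩
  calc ∑ a, (ξ s a - M.bellman h ζ s a) ^ 2 ≤ ∑ _a : A, (2 : ℝ) ^ 2 :=
        Finset.sum_le_sum fun a _ => sq_le_sq' (abs_le.1 (abs_sub_bellman_le hr hξ hζ s a)).1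
          (abs_le.1 (abs_sub_bellman_le hr hξ hζ s a)).2
    _ = Fintype.card A * 4 := by norm_num

theorem integrable_meanSqResidual (hr : ∀ s a, M.r h s a ≤ 1) (hξ : UnitValued ξ)
    (hζ : UnitValued ζ) (μ : Measure S) [IsFiniteMeasure μ] :
    Integrable (M.meanSqResidual h ξ ζ) μ :=
  .of_mem_Icc 0 4 (measurable_meanSqResidual hξ hζ).aemeasurable
    (.of_forall (meanSqResidual_mem_Icc hr hξ hζ))

variable [MeasurableSingletonClass A]

theorem lintegral_exp_neg_excessLoss_observationLaw_le (hr : ∀ s a, M.r h s a ≤ 1)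
    (hξ : UnitValued ξ) (hζ : UnitValued ζ) (s : S) :
    ∫⁻ z, ENNReal.ofReal (Real.exp (-(M.excessLoss h ξ ζ z / 8))) ∂M.observationLaw h s ≤
      ENNReal.ofReal (1 - M.meanSqResidual h ξ ζ s / 32) := by
  have hcard : (0 : ℝ) < Fintype.card A := by exact_mod_cast Fintype.card_pos
  have hnonneg (a : A) : 0 ≤ 1 - (ξ s a - M.bellman h ζ s a) ^ 2 / 32 := by
    nlinarith [abs_le.1 (abs_sub_bellman_le hr hξ hζ s a)]
  have hmeas : Measurable fun z => ENNReal.ofReal (Real.exp (-(M.excessLoss h ξ ζ z / 8))) :=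
    ((measurable_excessLoss hξ hζ).div_const 8).neg.exp.ennreal_ofReal
  rw [M.lintegral_observationLaw s hmeas]
  calc _ ≤ (Fintype.card A : ℝ≥0∞)⁻¹ *
        ∑ a, ENNReal.ofReal (1 - (ξ s a - M.bellman h ζ s a) ^ 2 / 32) := by
        gcongr with a; exact lintegral_exp_neg_excessLoss_le hr hξ hζ s a
    _ = ENNReal.ofReal ((Fintype.card A : ℝ)⁻¹ *
        ∑ a, (1 - (ξ s a - M.bellman h ζ s a) ^ 2 / 32)) := by
        rw [← ENNReal.ofReal_sum_of_nonneg fun a _ => hnonneg a,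
          ENNReal.ofReal_mul (inv_nonneg.2 hcard.le), ENNReal.ofReal_inv_of_pos hcard,
          ENNReal.ofReal_natCast]
    _ = _ := by
        simp [meanSqResidual, Finset.sum_sub_distrib, ← Finset.sum_div, mul_sub, mul_div_assoc,
          hcard.ne']

end ExcessLoss

/-- The two kinds of state distributions on which Bellman residuals are tested: the point mass at
the observed state, or the law of that state under the policy followed. -/
inductive TestKind
  | pointMass
  | rollIn

section TestLaw

/-- The distribution of test kind `t` at step `h` when `π` is followed and `s` is observed. Either
kind is a conditional law of the state observed at step `h`. -/
def testLaw (M : MDP S A) (t : TestKind) (π : ℕ → S → A) (h : ℕ) (s : S) : Measure S :=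
  match t with
  | .pointMass => Measure.dirac s
  | .rollIn => M.stateLaw π 0 M.s₁ h

variable {M : MDP S A} {t : TestKind} {h : ℕ} {π : ℕ → S → A}

theorem measurable_testLaw {Ω : Type*} [MeasurableSpace Ω] {π : Ω → ℕ → S → A}
    (hπ : ∀ m < h, Measurable (Function.uncurry fun ω => π ω m)) {s : Ω → S}
    (hs : Measurable s) : Measurable fun ω => M.testLaw t (π ω) h (s ω) := by
  cases t
  · exact Measure.measurable_dirac.comp hs
  · exact M.measurable_stateLaw (h := 0) M.s₁ (by simpa using hπ)

theorem isProbabilityMeasure_testLaw (hπ : ∀ m < h, Measurable (π m)) (s : S) :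
    IsProbabilityMeasure (M.testLaw t π h s) := by
  cases t
  · exact Measure.dirac.isProbabilityMeasure
  · exact M.isProbabilityMeasure_stateLaw (h := 0) M.s₁ (by simpa using hπ)

theorem lintegral_exp_integral_testLaw_mul_le (hπ : ∀ m < h, Measurable (π m)) {q : S → ℝ}
    (hq : Measurable q) (hq01 : ∀ s, q s ∈ Set.Icc (0 : ℝ) 1) :
    ∫⁻ s, ENNReal.ofReal (Real.exp (∫ s', q s' ∂M.testLaw t π h s)) * ENNReal.ofReal (1 - q s)
      ∂M.stateLaw π 0 M.s₁ h ≤ 1 := by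
  have := M.isProbabilityMeasure_stateLaw (h := 0) M.s₁ (n := h) (π := π) (by simpa using hπ)
  cases t with
  | pointMass =>
    simp only [testLaw, integral_dirac' _ _ hq.stronglyMeasurable]
    exact (lintegral_mono fun s => ofReal_exp_mul_ofReal_one_sub_le (q s)).trans (by simp)
  | rollIn =>
    simp only [testLaw]
    rw [lintegral_const_mul' _ _ ENNReal.ofReal_ne_top]
    exact ofReal_exp_integral_mul_lintegral_one_sub_le
      (.of_mem_Icc 0 1 hq.aemeasurable (.of_forall hq01)) fun s => (hq01 s).2

variable [Fintype A] {ξ ζ : S → A → ℝ}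

/-- The mean squared residual of `(ξ, ζ)` under the test distribution, minus the excess loss on the
observation `z`, each scaled so that the exponential of the difference has mean at most `1`. -/
def testIncrement (M : MDP S A) (t : TestKind) (π : ℕ → S → A) (h : ℕ) (ξ ζ : S → A → ℝ)
    (z : S × A × ℝ × S) : ℝ :=
  (∫ s, M.meanSqResidual h ξ ζ s ∂M.testLaw t π h z.1) / 32 - M.excessLoss h ξ ζ z / 8

theorem measurable_testIncrement {Ω : Type*} [MeasurableSpace Ω] {π : Ω → ℕ → S → A}
    (hπ : ∀ m < h, Measurable (Function.uncurry fun ω => π ω m)) (hξ : UnitValued ξ)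
    (hζ : UnitValued ζ) {z : Ω → S × A × ℝ × S} (hz : Measurable z) :
    Measurable fun ω => M.testIncrement t (π ω) h ξ ζ (z ω) := by
  have (ω : Ω) := isProbabilityMeasure_testLaw (M := M) (t := t)
    (fun m hm => (hπ m hm).of_uncurry_left (x := ω)) (z ω).1
  exact ((measurable_integral_of_family (measurable_testLaw hπ hz.fst)
    (g := fun _ => M.meanSqResidual h ξ ζ)
    ((measurable_meanSqResidual hξ hζ).comp measurable_snd)).div_const 32).sub
    (((measurable_excessLoss hξ hζ).comp hz).div_const 8)

variable [Nonempty A] [MeasurableSingletonClass A]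

theorem lintegral_exp_testIncrement_le (hπ : ∀ m < h, Measurable (π m))
    (hr : ∀ s a, M.r h s a ≤ 1) (hξ : UnitValued ξ) (hζ : UnitValued ζ) :
    ∫⁻ z, ENNReal.ofReal (Real.exp (M.testIncrement t π h ξ ζ z)) ∂M.tupleLaw π h ≤ 1 := by
  set q : S → ℝ := fun s => M.meanSqResidual h ξ ζ s / 32
  have hq : Measurable q := (measurable_meanSqResidual hξ hζ).div_const 32
  have hq01 (s : S) : q s ∈ Set.Icc (0 : ℝ) 1 := by
    have := meanSqResidual_mem_Icc hr hξ hζ s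
    constructor <;> simp only [q] <;> linarith [this.1, this.2]
  have := isProbabilityMeasure_testLaw (M := M) (t := t) hπ
  have hmean : Measurable fun s => ENNReal.ofReal (Real.exp (∫ s', q s' ∂M.testLaw t π h s)) :=
    (measurable_integral_of_family (measurable_testLaw (π := fun _ => π)
      (fun m hm => (hπ m hm).comp measurable_snd) measurable_id) (g := fun _ => q)
      (hq.comp measurable_snd)).exp.ennreal_ofReal
  have hexcess : Measurable fun z => ENNReal.ofReal (Real.exp (-(M.excessLoss h ξ ζ z / 8))) :=
    ((measurable_excessLoss hξ hζ).div_const 8).neg.exp.ennreal_ofReal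
  simp_rw [testIncrement, ← integral_div, sub_eq_add_neg, Real.exp_add,
    ENNReal.ofReal_mul (Real.exp_pos _).le]
  refine (M.lintegral_tupleLaw ((hmean.comp measurable_fst).mul hexcess)).trans_le ?_
  refine le_trans (lintegral_mono fun s => ?_)
    (lintegral_exp_integral_testLaw_mul_le (t := t) hπ hq hq01)
  exact (M.lintegral_observationLaw_fst_mul s hmean hexcess).trans_le
    (mul_le_mul_right (lintegral_exp_neg_excessLoss_observationLaw_le hr hξ hζ s) _)

end TestLaw

end MDP

/-! ### Telescoping and optimism -/

namespace MDP

section Telescoping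

variable {S A : Type*} [MeasurableSpace S] [MeasurableSpace A]

/-- The temporal difference `u_h - r_h - 𝔼 u_{h+1}` of state functions `u` under the policy `π`:
the amount by which `u` fails to satisfy the Bellman equation of `π` at step `h`. -/
def temporalDifference (M : MDP S A) (π : ℕ → S → A) (u : ℕ → S → ℝ) (h : ℕ) (s : S) : ℝ :=
  u h s - M.r h s (π h s) - ∫ s', u (h + 1) s' ∂M.P h (s, π h s)

variable {M : MDP S A} {π : ℕ → S → A} {u : ℕ → S → ℝ} {b : ℝ}

theorem V_nonneg (M : MDP S A) (π : ℕ → S → A) (h : ℕ) (s : S) : 0 ≤ M.V π h s :=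
  Finset.sum_nonneg fun _ _ => integral_nonneg fun _ => M.r_nonneg _ _ _

theorem integrable_reward {h : ℕ} (hr : ∀ s a, M.r h s a ≤ 1) (hπ : Measurable (π h))
    (μ : Measure S) [IsFiniteMeasure μ] : Integrable (fun s => M.r h s (π h s)) μ :=
  .of_mem_Icc 0 1 ((M.r_measurable h).comp (measurable_id.prodMk hπ)).aemeasurable
    (.of_forall fun _ => ⟨M.r_nonneg _ _ _, hr _ _⟩)

theorem integrable_integral_P {h : ℕ} (hπ : Measurable (π h)) {v : S → ℝ} (hv : Measurable v)
    (hb : ∀ s, |v s| ≤ b) (μ : Measure S) [IsFiniteMeasure μ] :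
    Integrable (fun s => ∫ s', v s' ∂M.P h (s, π h s)) μ := by
  have hm : Measurable fun s => ∫ s', v s' ∂M.P h (s, π h s) :=
    measurable_integral_of_family (κ := fun s => M.P h (s, π h s)) (g := fun _ => v)
      ((M.P h).measurable.comp (measurable_id.prodMk hπ)) (hv.comp measurable_snd)
  refine .of_bound hm.aestronglyMeasurable b (.of_forall fun s => ?_)
  simpa using norm_integral_le_of_norm_le_const (μ := M.P h (s, π h s)) (f := v) (.of_forall hb)

theorem integral_temporalDifference {h n : ℕ} (hr : ∀ s a, M.r (h + n) s a ≤ 1)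
    (hπ : ∀ m ≤ n, Measurable (π (h + m))) (hu : ∀ h, Measurable (u h))
    (hb : ∀ h s, |u h s| ≤ b) (s : S) :
    ∫ s', M.temporalDifference π u (h + n) s' ∂M.stateLaw π h s n =
      ∫ s', u (h + n) s' ∂M.stateLaw π h s n -
        ∫ s', M.r (h + n) s' (π (h + n) s') ∂M.stateLaw π h s n -
        ∫ s', u (h + (n + 1)) s' ∂M.stateLaw π h s (n + 1) := by
  have := M.isProbabilityMeasure_stateLaw s fun m (hm : m < n) => hπ m hm.le
  have hiu : Integrable (u (h + n)) (M.stateLaw π h s n) :=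
    .of_bound (hu _).aestronglyMeasurable b (.of_forall (hb _))
  have hir := integrable_reward hr (hπ n le_rfl) (M.stateLaw π h s n)
  rw [M.integral_stateLaw_succ s hπ (hu _) (hb _), ← integral_sub hiu hir]
  exact integral_sub (hiu.sub hir) (integrable_integral_P (hπ n le_rfl) (hu _) (hb _) _)

theorem sum_integral_temporalDifference (hr : ∀ h < M.H, ∀ s a, M.r h s a ≤ 1)
    (hπ : ∀ h < M.H, Measurable (π h)) (hu : ∀ h, Measurable (u h)) (hb : ∀ h s, |u h s| ≤ b)
    (h : ℕ) (s : S) {n : ℕ} (hn : h + n ≤ M.H) :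
    ∑ i ∈ Finset.range n, ∫ s', M.temporalDifference π u (h + i) s' ∂M.stateLaw π h s i =
      u h s - ∑ i ∈ Finset.range n, ∫ s', M.r (h + i) s' (π (h + i) s') ∂M.stateLaw π h s i -
        ∫ s', u (h + n) s' ∂M.stateLaw π h s n := by
  induction n with
  | zero => simp [stateLaw, integral_dirac' _ s (hu h).stronglyMeasurable]
  | succ n ih =>
    rw [Finset.sum_range_succ, ih (by omega), Finset.sum_range_succ,
      integral_temporalDifference (hr _ (by omega)) (fun m hm => hπ _ (by omega)) hu hb]
    ring

theorem sub_V_eq_sum_temporalDifference (hr : ∀ h < M.H, ∀ s a, M.r h s a ≤ 1)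
    (hπ : ∀ h < M.H, Measurable (π h)) (hu : ∀ h, Measurable (u h)) (hb : ∀ h s, |u h s| ≤ b)
    (huH : ∀ s, u M.H s = 0) {h : ℕ} (hh : h ≤ M.H) (s : S) :
    u h s - M.V π h s = ∑ i ∈ Finset.range (M.H - h),
      ∫ s', M.temporalDifference π u (h + i) s' ∂M.stateLaw π h s i := by
  rw [sum_integral_temporalDifference hr hπ hu hb h s (by omega), Nat.add_sub_cancel' hh]
  simp [huH, V]

end Telescoping

section Admissible

variable {S A : Type*} [MeasurableSpace S] [MeasurableSpace A]

/-- The standing assumptions on the MDP, the two function classes and the tie-breaking. -/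
structure Admissible (M : MDP S A) (F G : ℕ → Set (S → A → ℝ))
    (σ : ℕ → (S → A → ℝ) → S → A) : Prop where
  isValueClass : M.IsValueClass F
  isValueClass_target : M.IsValueClass G
  isGreedy : M.IsGreedy F σ
  realizable : M.Realizable F
  complete : M.GeneralizedComplete F G

/-- The tuple `Q^⋆` of the optimal `Q`-functions, extended by `0` from step `H` on. -/
def optimalQ (M : MDP S A) (h : ℕ) : S → A → ℝ := if h < M.H then M.Qstar h else 0

/-- The state-wise Bellman residual of `f` at its greedy action, i.e. the element of
`residualClass` that belongs to `f`. -/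
def residual (M : MDP S A) (σ : ℕ → (S → A → ℝ) → S → A) (f : ℕ → S → A → ℝ) (h : ℕ) (s : S) : ℝ :=
  f h s (σ h (f h) s) - M.bellman h (f (h + 1)) s (σ h (f h) s)

variable {M : MDP S A} {F G : ℕ → Set (S → A → ℝ)} {σ : ℕ → (S → A → ℝ) → S → A}
  {f : ℕ → S → A → ℝ} {h : ℕ}

theorem IsValueClass.unitValued (hF : M.IsValueClass F) (hf : f ∈ M.tuples F) (h : ℕ) :
    UnitValued (f h) := by
  by_cases hh : h < M.H
  · obtain ⟨hmeas, hIcc⟩ := hF h hh _ (hf.1 h hh)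
    exact ⟨hmeas, hIcc⟩
  · rw [hf.2 h (by omega)]
    exact UnitValued.zero

namespace Admissible

theorem optimalQ_mem (ha : M.Admissible F G σ) : M.optimalQ ∈ M.tuples F :=
  ⟨fun h hh => by rw [optimalQ, if_pos hh]; exact ha.realizable h hh,
    fun h hh => by rw [optimalQ, if_neg hh.not_gt]⟩

theorem measurable_greedyPolicy (ha : M.Admissible F G σ) (hf : f ∈ M.tuples F) (hh : h < M.H) :
    Measurable (greedyPolicy σ f h) :=
  (ha.isGreedy h hh _ (hf.1 h hh)).1

/-- The greedy policy of a tuple as an element of the type of policies. -/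
def policy (ha : M.Admissible F G σ) (hf : f ∈ M.tuples F) : M.Policy :=
  ⟨greedyPolicy σ f, fun _ hh => ha.measurable_greedyPolicy hf hh⟩

variable [Finite A] [Nonempty A]

theorem actionMax_eq (ha : M.Admissible F G σ) (hf : f ∈ M.tuples F) (hh : h < M.H) (s : S) :
    actionMax (f h) s = f h s (greedyPolicy σ f h s) :=
  VGolf.actionMax_eq ((ha.isGreedy h hh _ (hf.1 h hh)).2 s)

theorem reward_le (ha : M.Admissible F G σ) (hh : h < M.H) (s : S) (a : A) : M.r h s a ≤ 1 := by
  have hle := ((ha.isValueClass_target h hh _ (ha.complete _ ha.optimalQ_mem h hh)).2 s a).2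
  rw [bellman_eq] at hle
  linarith [((ha.isValueClass.unitValued ha.optimalQ_mem (h + 1)).integral_actionMax_mem_Icc
    (M.P h (s, a))).1]

theorem actionMax_sub_V (ha : M.Admissible F G σ) (hf : f ∈ M.tuples F) {π : ℕ → S → A}
    (hπ : ∀ h < M.H, Measurable (π h)) (hh : h ≤ M.H) (s : S) :
    actionMax (f h) s - M.V π h s = ∑ i ∈ Finset.range (M.H - h),
      ∫ s', M.temporalDifference π (fun h => actionMax (f h)) (h + i) s' ∂M.stateLaw π h s i :=
  sub_V_eq_sum_temporalDifference (u := fun h => actionMax (f h)) (b := 1)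
    (fun _ => ha.reward_le) hπ (fun h => (ha.isValueClass.unitValued hf h).measurable_actionMax)
    (fun h s => by
      have hmem := (ha.isValueClass.unitValued hf h).actionMax_mem_Icc s
      exact abs_le.2 ⟨by linarith [hmem.1], hmem.2⟩)
    (fun s => by simp [actionMax, hf.2 M.H le_rfl]) hh s

theorem temporalDifference_greedyPolicy (ha : M.Admissible F G σ) (hf : f ∈ M.tuples F)
    (hh : h < M.H) (s : S) :
    M.temporalDifference (greedyPolicy σ f) (fun h => actionMax (f h)) h s =
      M.residual σ f h s := by
  rw [temporalDifference, ha.actionMax_eq hf hh, residual, bellman_eq, sub_sub]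
  rfl

theorem actionMax_sub_V_greedyPolicy (ha : M.Admissible F G σ) (hf : f ∈ M.tuples F)
    (hh : h ≤ M.H) (s : S) :
    actionMax (f h) s - M.V (greedyPolicy σ f) h s = ∑ i ∈ Finset.range (M.H - h),
      ∫ s', M.residual σ f (h + i) s' ∂M.stateLaw (greedyPolicy σ f) h s i := by
  rw [ha.actionMax_sub_V hf (fun _ hm => ha.measurable_greedyPolicy hf hm) hh]
  refine Finset.sum_congr rfl fun i hi => integral_congr_ae (.of_forall fun s' => ?_)
  exact ha.temporalDifference_greedyPolicy hf (by have := Finset.mem_range.1 hi; omega) s'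

theorem V_le_actionMax_of_bellman_le (ha : M.Admissible F G σ) (hf : f ∈ M.tuples F)
    (hh : h ≤ M.H) (hbellman : ∀ m, h ≤ m → m < M.H → M.bellman m (f (m + 1)) ≤ f m)
    (π : M.Policy) (s : S) : M.V π.1 h s ≤ actionMax (f h) s := by
  rw [← sub_nonneg, ha.actionMax_sub_V hf π.2 hh]
  refine Finset.sum_nonneg fun i hi => integral_nonneg fun s' => ?_
  have hle := hbellman (h + i) (by omega) (by have := Finset.mem_range.1 hi; omega) s'
    (π.1 (h + i) s')
  rw [bellman_eq] at hle
  simp only [temporalDifference, Pi.zero_apply]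
  linarith [le_actionMax (f (h + i)) s' (π.1 (h + i) s')]

theorem V_greedyPolicy_eq_actionMax (ha : M.Admissible F G σ) (hf : f ∈ M.tuples F)
    (hh : h ≤ M.H) (hbellman : ∀ m, h ≤ m → m < M.H → M.bellman m (f (m + 1)) = f m) (s : S) :
    M.V (greedyPolicy σ f) h s = actionMax (f h) s := by
  rw [eq_comm, ← sub_eq_zero, ha.actionMax_sub_V_greedyPolicy hf hh]
  refine Finset.sum_eq_zero fun i hi => integral_eq_zero_of_ae (.of_forall fun s' => ?_)
  have := Finset.mem_range.1 hi
  simp [residual, hbellman (h + i) (by omega) (by omega)]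

theorem Qstar_eq_bellman_of_forall_gt (ha : M.Admissible F G σ) (hh : h < M.H)
    (hbellman : ∀ m, h < m → m < M.H → M.bellman m (M.optimalQ (m + 1)) = M.optimalQ m) :
    M.Qstar h = M.bellman h (M.optimalQ (h + 1)) := by
  have hq := ha.optimalQ_mem
  funext s a
  have hle (π : M.Policy) : M.Q π.1 h s a ≤ M.bellman h (M.optimalQ (h + 1)) s a := by
    rw [bellman_eq, Q]
    refine add_le_add le_rfl ?_
    refine integral_mono_of_nonneg (.of_forall fun _ => M.V_nonneg _ _ _)
      ((ha.isValueClass.unitValued hq (h + 1)).integrable_actionMax _) (.of_forall fun s' => ?_)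
    exact ha.V_le_actionMax_of_bellman_le hq hh (fun m hm hmH => (hbellman m hm hmH).le) π s'
  have hgreedy : M.Q (ha.policy hq).1 h s a = M.bellman h (M.optimalQ (h + 1)) s a := by
    simp only [Q, bellman_eq, policy, ha.V_greedyPolicy_eq_actionMax hq hh hbellman]
  have : Nonempty M.Policy := ⟨ha.policy hq⟩
  exact le_antisymm (ciSup_le hle)
    (hgreedy ▸ le_ciSup (f := fun π : M.Policy => M.Q π.1 h s a)
      ⟨_, Set.forall_mem_range.2 hle⟩ (ha.policy hq))

theorem bellman_optimalQ (ha : M.Admissible F G σ) (hh : h < M.H) :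
    M.bellman h (M.optimalQ (h + 1)) = M.optimalQ h := by
  induction hn : M.H - h using Nat.strong_induction_on generalizing h with
  | h n ih =>
    rw [optimalQ, optimalQ, if_pos hh, ← optimalQ]
    exact (ha.Qstar_eq_bellman_of_forall_gt hh fun m hm hmH => ih _ (by omega) hmH rfl).symm

theorem Vstar_le (ha : M.Admissible F G σ) : M.Vstar 0 M.s₁ ≤ actionMax (M.optimalQ 0) M.s₁ :=
  have : Nonempty M.Policy := ⟨ha.policy ha.optimalQ_mem⟩
  ciSup_le fun π => ha.V_le_actionMax_of_bellman_le ha.optimalQ_mem (Nat.zero_le _)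
    (fun _ _ hm => (ha.bellman_optimalQ hm).le) π M.s₁

theorem isOptimalUpTo_of_one_le (ha : M.Admissible F G σ) {η : ℝ} (hη : 1 ≤ η) (π : ℕ → S → A) :
    M.IsOptimalUpTo η π := by
  have hle := (ha.isValueClass.unitValued ha.optimalQ_mem 0).actionMax_mem_Icc M.s₁
  rw [IsOptimalUpTo]
  linarith [ha.Vstar_le, hle.2, M.V_nonneg π 0 M.s₁]

end Admissible

end Admissible

end MDP

/-! ### Confidence sets -/

section SquaredDifference

variable {x x' ρ : ℝ}

theorem abs_sq_sub_sq_le {b : ℝ} (hx : |x| ≤ b) (hx' : |x'| ≤ b) (h : |x - x'| ≤ ρ) :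
    |x ^ 2 - x' ^ 2| ≤ 2 * b * ρ := by
  rw [sq_sub_sq, abs_mul]
  exact mul_le_mul ((abs_add_le x x').trans (by linarith)) h (abs_nonneg _)
    (by linarith [abs_nonneg x])

theorem abs_sq_prediction_error_sub_le {r v v' : ℝ} (hx : x ∈ Set.Icc (0 : ℝ) 2)
    (hx' : x' ∈ Set.Icc (0 : ℝ) 2) (hr : r ∈ Set.Icc (0 : ℝ) 1) (hv : v ∈ Set.Icc (0 : ℝ) 1)
    (hv' : v' ∈ Set.Icc (0 : ℝ) 1) (hxx' : |x - x'| ≤ ρ) (hvv' : |v - v'| ≤ ρ) :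
    |(x - r - v) ^ 2 - (x' - r - v') ^ 2| ≤ 8 * ρ := by
  rw [Set.mem_Icc] at hx hx' hr hv hv'
  rw [abs_le] at hxx' hvv'
  calc _ ≤ 2 * 2 * (2 * ρ) := abs_sq_sub_sq_le (abs_le.2 ⟨by linarith, by linarith⟩)
        (abs_le.2 ⟨by linarith, by linarith⟩) (abs_le.2 ⟨by linarith, by linarith⟩)
    _ = 8 * ρ := by ring

theorem sq_integral_le_integral_sq {X : Type*} [MeasurableSpace X] {μ : Measure X}
    [IsProbabilityMeasure μ] {f : X → ℝ} (hf : MemLp f 2 μ) :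
    (∫ x, f x ∂μ) ^ 2 ≤ ∫ x, f x ^ 2 ∂μ :=
  sub_nonneg.1 ((variance_nonneg f μ).trans_eq (variance_eq_sub hf))

end SquaredDifference

/-- `W` is a `ρ`-cover of `V` by elements of `V`, for the distance `max_h ‖f_h - g_h‖_∞`. -/
def IsCover {S A : Type*} (V W : Set (ℕ → S → A → ℝ)) (ρ : ℝ) : Prop :=
  W ⊆ V ∧ ∀ f ∈ V, ∃ w ∈ W, ∀ h s a, |f h s a - w h s a| ≤ ρ

namespace MDP

variable {S A : Type*} [MeasurableSpace S] [MeasurableSpace A] {M : MDP S A}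

section Perturbation

variable [Nonempty A] {h : ℕ} {ξ ζ ξ' ζ' : S → A → ℝ} {ρ : ℝ}

theorem abs_excessLoss_sub_le [Finite A] (hr : ∀ s a, M.r h s a ≤ 1) (hξ : UnitValued ξ)
    (hζ : UnitValued ζ) (hξ' : UnitValued ξ') (hζ' : UnitValued ζ')
    (hξξ' : ∀ s a, |ξ s a - ξ' s a| ≤ ρ) (hζζ' : ∀ s a, |ζ s a - ζ' s a| ≤ ρ)
    {z : S × A × ℝ × S} (hz : z.2.2.1 ∈ Set.Icc (0 : ℝ) 1) :
    |M.excessLoss h ξ ζ z - M.excessLoss h ξ' ζ' z| ≤ 16 * ρ := by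
  obtain ⟨s, a, r, s'⟩ := z
  have hmax := hζ.actionMax_mem_Icc s'
  have hmax' := hζ'.actionMax_mem_Icc s'
  have hmax_close : |actionMax ζ s' - actionMax ζ' s'| ≤ ρ := abs_actionMax_sub_le (hζζ' s')
  have hunit : Set.Icc (0 : ℝ) 1 ⊆ Set.Icc 0 2 := Set.Icc_subset_Icc_right one_le_two
  have hloss := abs_le.1 (abs_sq_prediction_error_sub_le (hunit (hξ.mem_Icc s a))
    (hunit (hξ'.mem_Icc s a)) hz hmax hmax' (hξξ' s a) hmax_close)
  have hbackup := abs_le.1 (abs_sq_prediction_error_sub_le (bellman_mem_Icc hr hζ s a)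
    (bellman_mem_Icc hr hζ' s a) hz hmax hmax' (abs_bellman_sub_le hζ hζ' hζζ' s a) hmax_close)
  simp only [excessLoss]
  exact abs_le.2 ⟨by linarith, by linarith⟩

variable [Fintype A]

theorem meanSqResidual_le_add (hr : ∀ s a, M.r h s a ≤ 1) (hξ : UnitValued ξ) (hζ : UnitValued ζ)
    (hξ' : UnitValued ξ') (hζ' : UnitValued ζ') (hξξ' : ∀ s a, |ξ s a - ξ' s a| ≤ ρ)
    (hζζ' : ∀ s a, |ζ s a - ζ' s a| ≤ ρ) (s : S) :
    M.meanSqResidual h ξ ζ s ≤ M.meanSqResidual h ξ' ζ' s + 8 * ρ := by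
  have hcard : (0 : ℝ) < Fintype.card A := by exact_mod_cast Fintype.card_pos
  have hresidual (a : A) : (ξ s a - M.bellman h ζ s a) ^ 2 ≤
      (ξ' s a - M.bellman h ζ' s a) ^ 2 + 8 * ρ := by
    have hclose := abs_le.1 (abs_bellman_sub_le (M := M) (h := h) hζ hζ' hζζ' s a)
    have hclose' := abs_le.1 (hξξ' s a)
    linarith [(abs_le.1 (abs_sq_sub_sq_le (ρ := 2 * ρ) (abs_sub_bellman_le hr hξ hζ s a)
      (abs_sub_bellman_le hr hξ' hζ' s a) (abs_le.2 ⟨by linarith, by linarith⟩))).2]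
  rw [meanSqResidual, meanSqResidual, inv_mul_le_iff₀ hcard, mul_add,
    mul_inv_cancel_left₀ hcard.ne']
  refine (Finset.sum_le_sum fun a _ => hresidual a).trans_eq ?_
  simp [Finset.sum_add_distrib]

theorem integral_meanSqResidual_le_add (hr : ∀ s a, M.r h s a ≤ 1) (hξ : UnitValued ξ)
    (hζ : UnitValued ζ) (hξ' : UnitValued ξ') (hζ' : UnitValued ζ')
    (hξξ' : ∀ s a, |ξ s a - ξ' s a| ≤ ρ) (hζζ' : ∀ s a, |ζ s a - ζ' s a| ≤ ρ) (μ : Measure S)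
    [IsProbabilityMeasure μ] :
    ∫ s, M.meanSqResidual h ξ ζ s ∂μ ≤ ∫ s, M.meanSqResidual h ξ' ζ' s ∂μ + 8 * ρ := by
  have hi' := integrable_meanSqResidual hr hξ' hζ' μ
  calc ∫ s, M.meanSqResidual h ξ ζ s ∂μ ≤ ∫ s, (M.meanSqResidual h ξ' ζ' s + 8 * ρ) ∂μ :=
        integral_mono (integrable_meanSqResidual hr hξ hζ μ) (hi'.add (integrable_const _))
          (meanSqResidual_le_add hr hξ hζ hξ' hζ' hξξ' hζζ')
    _ = ∫ s, M.meanSqResidual h ξ' ζ' s ∂μ + 8 * ρ := by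
        simp [integral_add hi' (integrable_const _)]

end Perturbation

section Residual

variable {F G : ℕ → Set (S → A → ℝ)} {σ : ℕ → (S → A → ℝ) → S → A} {f : ℕ → S → A → ℝ} {h : ℕ}

theorem Admissible.abs_residual_le_one (ha : M.Admissible F G σ) (hf : f ∈ M.tuples F)
    (hh : h < M.H) (s : S) : |M.residual σ f h s| ≤ 1 := by
  have hval := (ha.isValueClass.unitValued hf h).mem_Icc s (σ h (f h) s)
  have hbackup := (ha.isValueClass_target h hh _ (ha.complete f hf h hh)).2 s (σ h (f h) s)
  rw [residual]
  exact abs_le.2 ⟨by linarith [hval.1, hbackup.2], by linarith [hval.2, hbackup.1]⟩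

theorem Admissible.measurable_residual [Finite A] (ha : M.Admissible F G σ) (hf : f ∈ M.tuples F)
    (hh : h < M.H) : Measurable (M.residual σ f h) := by
  have hgreedy : Measurable fun s => (s, σ h (f h) s) :=
    measurable_id.prodMk (ha.measurable_greedyPolicy hf hh)
  exact ((ha.isValueClass.unitValued hf h).measurable.comp hgreedy).sub
    ((measurable_bellman (ha.isValueClass.unitValued hf (h + 1))).comp hgreedy)

variable [Fintype A] [Nonempty A]

theorem sq_residual_le (M : MDP S A) (σ : ℕ → (S → A → ℝ) → S → A) (f : ℕ → S → A → ℝ) (h : ℕ)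
    (s : S) :
    M.residual σ f h s ^ 2 ≤ Fintype.card A * M.meanSqResidual h (f h) (f (h + 1)) s := by
  rw [meanSqResidual, mul_inv_cancel_left₀ (by exact_mod_cast Fintype.card_ne_zero), residual]
  exact Finset.single_le_sum (f := fun a => (f h s a - M.bellman h (f (h + 1)) s a) ^ 2)
    (fun _ _ => sq_nonneg _) (Finset.mem_univ _)

theorem Admissible.sq_integral_residual_le (ha : M.Admissible F G σ) (hf : f ∈ M.tuples F)
    (hh : h < M.H) (μ : Measure S) [IsProbabilityMeasure μ] :
    (∫ s, M.residual σ f h s ∂μ) ^ 2 ≤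
      Fintype.card A * ∫ s, M.meanSqResidual h (f h) (f (h + 1)) s ∂μ := by
  have hL2 : MemLp (M.residual σ f h) 2 μ :=
    .of_bound (ha.measurable_residual hf hh).aestronglyMeasurable 1
      (.of_forall (ha.abs_residual_le_one hf hh))
  refine (sq_integral_le_integral_sq hL2).trans ?_
  rw [← integral_const_mul]
  exact integral_mono hL2.integrable_sq ((integrable_meanSqResidual (fun _ => ha.reward_le hh _)
    (ha.isValueClass.unitValued hf h) (ha.isValueClass.unitValued hf (h + 1)) μ).const_mul _)
    (M.sq_residual_le σ f h)

end Residual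

section Confidence

/-- The amount by which the accumulated mean squared residual of `(ξ, ζ)` under the test laws `ν i`
exceeds the accumulated excess loss on the data, each scaled as in `testIncrement`. -/
def deviation [Fintype A] (M : MDP S A) {k : ℕ} (ν : Fin k → Measure S) (h : Fin M.H)
    (ξ ζ : S → A → ℝ) (D : Fin k → M.Epoch) : ℝ :=
  ∑ i, ((∫ s, M.meanSqResidual h ξ ζ s ∂ν i) / 32 - M.excessLoss h ξ ζ (D i h) / 8)

variable {F G : ℕ → Set (S → A → ℝ)} {σ : ℕ → (S → A → ℝ) → S → A} {k : ℕ}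
  {D : Fin k → M.Epoch} {h : Fin M.H} {ν : Fin k → Measure S} {ρ θ β : ℝ}
  {ξ ζ ξ' ζ' : S → A → ℝ}

theorem deviation_eq [Fintype A] : M.deviation ν h ξ ζ D =
    (∑ i, ∫ s, M.meanSqResidual h ξ ζ s ∂ν i) / 32 - (∑ i, M.excessLoss h ξ ζ (D i h)) / 8 := by
  rw [deviation, Finset.sum_sub_distrib, Finset.sum_div, Finset.sum_div]

theorem sum_excessLoss_eq (D : Fin k → M.Epoch) (h : Fin M.H) (ξ ζ : S → A → ℝ) :
    ∑ i, M.excessLoss h ξ ζ (D i h) = M.loss D h ξ ζ - M.loss D h (M.bellman h ζ) ζ := by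
  rw [loss, loss, ← Finset.sum_sub_distrib]
  rfl

theorem abs_sum_excessLoss_sub_le [Finite A] [Nonempty A] (hr : ∀ s a, M.r h s a ≤ 1)
    (hD : ∀ i, (D i h).2.2.1 ∈ Set.Icc (0 : ℝ) 1) (hξ : UnitValued ξ) (hζ : UnitValued ζ)
    (hξ' : UnitValued ξ') (hζ' : UnitValued ζ') (hξξ' : ∀ s a, |ξ s a - ξ' s a| ≤ ρ)
    (hζζ' : ∀ s a, |ζ s a - ζ' s a| ≤ ρ) :
    |∑ i, M.excessLoss h ξ ζ (D i h) - ∑ i, M.excessLoss h ξ' ζ' (D i h)| ≤ 16 * (k * ρ) := by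
  rw [← Finset.sum_sub_distrib]
  calc _ ≤ ∑ i, |M.excessLoss h ξ ζ (D i h) - M.excessLoss h ξ' ζ' (D i h)| :=
        Finset.abs_sum_le_sum_abs _ _
    _ ≤ ∑ _i : Fin k, 16 * ρ := Finset.sum_le_sum fun i _ =>
        abs_excessLoss_sub_le hr hξ hζ hξ' hζ' hξξ' hζζ' (hD i)
    _ = 16 * (k * ρ) := by simp; ring

theorem iInf_loss_le {G : Set (S → A → ℝ)} {g : S → A → ℝ} (hg : g ∈ G) (D : Fin k → M.Epoch)
    (h : Fin M.H) (ζ : S → A → ℝ) : ⨅ g : G, M.loss D h g.1 ζ ≤ M.loss D h g ζ :=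
  ciInf_le (f := fun g : G => M.loss D h g.1 ζ)
    ⟨0, Set.forall_mem_range.2 fun _ => Finset.sum_nonneg fun _ _ => sq_nonneg _⟩ ⟨g, hg⟩

namespace Admissible

theorem exists_tuple_eq (ha : M.Admissible F G σ) {g : S → A → ℝ} {h : ℕ} (hh : h < M.H)
    (hg : g ∈ G h) : ∃ g' ∈ M.tuples G, g' h = g := by
  refine ⟨Function.update (fun m => if m < M.H then M.bellman m (M.optimalQ (m + 1)) else 0) h g,
    ⟨fun m hm => ?_, fun m hm => ?_⟩, Function.update_self ..⟩
  · obtain rfl | hne := eq_or_ne m h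
    · rwa [Function.update_self]
    · rw [Function.update_of_ne hne, if_pos hm]
      exact ha.complete _ ha.optimalQ_mem m hm
  · rw [Function.update_of_ne (by omega), if_neg (by omega)]

theorem unitValued_of_mem_union (ha : M.Admissible F G σ) {w : ℕ → S → A → ℝ}
    (hw : w ∈ M.tuples F ∪ M.tuples G) (h : ℕ) : UnitValued (w h) :=
  hw.elim (ha.isValueClass.unitValued · h) (ha.isValueClass_target.unitValued · h)

variable [Fintype A] [Nonempty A] {W : Set (ℕ → S → A → ℝ)}

theorem optimalQ_mem_confidenceSet (ha : M.Admissible F G σ)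
    (hW : IsCover (M.tuples F ∪ M.tuples G) W ρ)
    (hD : ∀ i h, (D i h).2.2.1 ∈ Set.Icc (0 : ℝ) 1) (hρ : 0 ≤ ρ) {ν : Fin M.H → Fin k → Measure S}
    (hdev : ∀ h : Fin M.H, ∀ w ∈ W, M.deviation (ν h) h (w h) (M.optimalQ (h + 1)) D ≤ θ)
    (hβ : 8 * θ + 16 * (k * ρ) ≤ β) : M.optimalQ ∈ M.confidenceSet F G β D := by
  refine ⟨ha.optimalQ_mem, fun h => ?_⟩
  have : Nonempty (G h) := ⟨⟨_, ha.complete _ ha.optimalQ_mem h h.2⟩⟩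
  rw [← sub_le_iff_le_add]
  refine le_ciInf fun ⟨g, hg⟩ => ?_
  obtain ⟨g', hg', rfl⟩ := ha.exists_tuple_eq h.2 hg
  obtain ⟨w, hw, hclose⟩ := hW.2 g' (Or.inr hg')
  have hr (s : S) (a : A) := ha.reward_le h.2 s a
  have hQ := ha.isValueClass.unitValued ha.optimalQ_mem (h + 1)
  have hwU := ha.unitValued_of_mem_union (hW.1 hw) h
  have hperturb := abs_le.1 (abs_sum_excessLoss_sub_le (h := h) (ζ := M.optimalQ (h + 1)) hr
    (fun i => hD i h) (ha.isValueClass_target.unitValued hg' h) hQ hwU hQ (hclose h)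
    fun s a => by simpa using hρ)
  have hnonneg : 0 ≤ ∑ i, ∫ s, M.meanSqResidual h (w h) (M.optimalQ (h + 1)) s ∂ν h i :=
    Finset.sum_nonneg fun i _ => integral_nonneg fun s => (meanSqResidual_mem_Icc hr hwU hQ s).1
  have hsmall := hdev h w hw
  have hexcess := sum_excessLoss_eq D h (g' h) (M.optimalQ (h + 1))
  rw [deviation_eq] at hsmall
  rw [ha.bellman_optimalQ h.2] at hexcess
  linarith

theorem sum_sq_integral_residual_le (ha : M.Admissible F G σ)
    (hW : IsCover (M.tuples F ∪ M.tuples G) W ρ)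
    (hD : ∀ i, (D i h).2.2.1 ∈ Set.Icc (0 : ℝ) 1) [∀ i, IsProbabilityMeasure (ν i)]
    (hdev : ∀ w ∈ W, M.deviation ν h (w h) (w (h + 1)) D ≤ θ) {f : ℕ → S → A → ℝ}
    (hf : f ∈ M.confidenceSet F G β D) :
    ∑ i, (∫ s, M.residual σ f h s ∂ν i) ^ 2 ≤
      Fintype.card A * (32 * θ + 4 * β + 72 * (k * ρ)) := by
  obtain ⟨hfF, hfβ⟩ := hf
  obtain ⟨w, hw, hclose⟩ := hW.2 f (Or.inl hfF)
  have hr (s : S) (a : A) := ha.reward_le h.2 s a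
  have hfU := ha.isValueClass.unitValued hfF
  have hwU := ha.unitValued_of_mem_union (hW.1 hw)
  have hperturb := abs_le.1 (abs_sum_excessLoss_sub_le hr hD (hfU h) (hfU (h + 1))
    (hwU h) (hwU (h + 1)) (hclose h) (hclose (h + 1)))
  have hexcess : ∑ i, M.excessLoss h (f h) (f (h + 1)) (D i h) ≤ β := by
    rw [sum_excessLoss_eq]
    linarith [hfβ h, iInf_loss_le (ha.complete f hfF h h.2) D h (f (h + 1))]
  have hsmall := hdev w hw
  rw [deviation_eq] at hsmall
  have hmeanSq : ∑ i, ∫ s, M.meanSqResidual h (f h) (f (h + 1)) s ∂ν i ≤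
      ∑ i, ∫ s, M.meanSqResidual h (w h) (w (h + 1)) s ∂ν i + 8 * (k * ρ) := by
    refine (Finset.sum_le_sum fun i _ => integral_meanSqResidual_le_add hr (hfU h) (hfU (h + 1))
      (hwU h) (hwU (h + 1)) (hclose h) (hclose (h + 1)) (ν i)).trans_eq ?_
    simp [Finset.sum_add_distrib, mul_left_comm]
  calc ∑ i, (∫ s, M.residual σ f h s ∂ν i) ^ 2
      ≤ ∑ i, Fintype.card A * ∫ s, M.meanSqResidual h (f h) (f (h + 1)) s ∂ν i :=
        Finset.sum_le_sum fun i _ => ha.sq_integral_residual_le hfF h.2 (ν i)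
    _ = Fintype.card A * ∑ i, ∫ s, M.meanSqResidual h (f h) (f (h + 1)) s ∂ν i := by
        rw [Finset.mul_sum]
    _ ≤ _ := by gcongr; linarith

end Admissible

end Confidence

end MDP

/-! ### Concentration along a run -/

namespace MDP

section Run

variable {S A : Type*} [MeasurableSpace S] [MeasurableSpace A]

/-- Law of the data of the epoch that follows the epochs with data `D`. -/
def nextEpochLaw (M : MDP S A) (σ : ℕ → (S → A → ℝ) → S → A)
    (sel : (k : ℕ) → (Fin k → M.Epoch) → ℕ → S → A → ℝ) (k : ℕ) (D : Fin k → M.Epoch) :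
    Measure M.Epoch :=
  M.epochLaw (greedyPolicy σ (sel k D))

/-- The test distribution of kind `t` at step `h` for epoch `i` of a run with data `D`. -/
def pastTestLaw (M : MDP S A) (t : TestKind) (σ : ℕ → (S → A → ℝ) → S → A)
    (sel : (k : ℕ) → (Fin k → M.Epoch) → ℕ → S → A → ℝ) {k : ℕ} (D : Fin k → M.Epoch)
    (h : Fin M.H) (i : Fin k) : Measure S :=
  M.testLaw t (M.policyAt σ sel D i) h (D i h).1

/-- The squared mean residuals, at step `h` and on the test distributions of the past epochs, of
the function chosen after the data `D`. -/
def pastSqError (M : MDP S A) (t : TestKind) (σ : ℕ → (S → A → ℝ) → S → A)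
    (sel : (k : ℕ) → (Fin k → M.Epoch) → ℕ → S → A → ℝ) {k : ℕ} (D : Fin k → M.Epoch)
    (h : Fin M.H) : ℝ :=
  ∑ i, (∫ s, M.residual σ (sel k D) h s ∂M.pastTestLaw t σ sel D h i) ^ 2

variable {M : MDP S A} {σ : ℕ → (S → A → ℝ) → S → A}
  {sel : (k : ℕ) → (Fin k → M.Epoch) → ℕ → S → A → ℝ}

theorem dataLaw_eq_adaptiveLaw (k : ℕ) :
    M.dataLaw σ sel k = adaptiveLaw (M.nextEpochLaw σ sel) k := by
  induction k with
  | zero => rfl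
  | succ k ih => rw [dataLaw, adaptiveLaw, ih]; rfl

theorem ae_reward_mem_epochLaw [Finite A] [Nonempty A] [MeasurableSingletonClass A]
    {π : ℕ → S → A} (hπ : ∀ m < M.H, Measurable (π m)) (hr : ∀ h < M.H, ∀ s a, M.r h s a ≤ 1) :
    ∀ᵐ e ∂M.epochLaw π, ∀ h, (e h).2.2.1 ∈ Set.Icc (0 : ℝ) 1 := by
  cases nonempty_fintype A
  refine ae_all_iff.2 fun h => ?_
  set B : Set (S × A × ℝ × S) := {z | z.2.2.1 ∈ Set.Icc (0 : ℝ) 1}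
  have hB : MeasurableSet B := measurable_snd.snd.fst measurableSet_Icc
  have hmeas : Measurable (Bᶜ.indicator (1 : S × A × ℝ × S → ℝ≥0∞)) :=
    measurable_one.indicator hB.compl
  have hzero : ∫⁻ e, Bᶜ.indicator 1 (e h) ∂M.epochLaw π = 0 := by
    rw [M.lintegral_epochLaw_eval hπ h hmeas, M.lintegral_tupleLaw hmeas]
    simp_rw [M.lintegral_observationLaw _ hmeas]
    simp [B, Set.indicator, M.r_nonneg, hr h h.2]
  filter_upwards [(lintegral_eq_zero_iff (hmeas.comp (measurable_pi_apply h))).1 hzero] with e he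
  have hmem : e h ∈ B := by simpa using he
  exact hmem

end Run

section Concentration

variable {S A : Type*} [MeasurableSpace S] [MeasurableSpace A] [Fintype A]

/-- On the data `D`, no deviation over `W` exceeds `θ`: neither for targets built from the member
of `W` itself, nor for targets built from `Q^⋆`. -/
def IsConcentrated (M : MDP S A) (t : TestKind) (σ : ℕ → (S → A → ℝ) → S → A)
    (sel : (k : ℕ) → (Fin k → M.Epoch) → ℕ → S → A → ℝ) (W : Set (ℕ → S → A → ℝ)) (θ : ℝ)
    {k : ℕ} (D : Fin k → M.Epoch) : Prop :=
  ∀ h, ∀ w ∈ W, M.deviation (M.pastTestLaw t σ sel D h) h (w h) (w (h + 1)) D ≤ θ ∧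
    M.deviation (M.pastTestLaw t σ sel D h) h (w h) (M.optimalQ (h + 1)) D ≤ θ

end Concentration

namespace IsVGolf

variable {S A : Type*} [MeasurableSpace S] [MeasurableSpace A] {M : MDP S A}
  {F G : ℕ → Set (S → A → ℝ)} {σ : ℕ → (S → A → ℝ) → S → A} {K k : ℕ} {β : ℝ}
  {sel : (k : ℕ) → (Fin k → M.Epoch) → ℕ → S → A → ℝ} {t : TestKind}

section Measurability

theorem measurable_greedyPolicy (hsel : M.IsVGolf F G σ K β sel) (ha : M.Admissible F G σ)
    (hk : k < K) (D : Fin k → M.Epoch) {h : ℕ} (hh : h < M.H) :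
    Measurable (greedyPolicy σ (sel k D) h) :=
  ha.measurable_greedyPolicy (hsel.mem k hk D) hh

theorem isAdaptiveSampling [Finite A] [Nonempty A] [MeasurableSingletonClass A]
    (hsel : M.IsVGolf F G σ K β sel) (ha : M.Admissible F G σ) :
    IsAdaptiveSampling (M.nextEpochLaw σ sel) K := by
  cases nonempty_fintype A
  exact ⟨fun k hk => M.measurable_epochLaw (π := fun D => greedyPolicy σ (sel k D))
    (hsel.measurable_policy k hk), fun k hk D => M.isProbabilityMeasure_epochLaw fun _ hm =>
      hsel.measurable_greedyPolicy ha hk D hm⟩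

theorem measurable_testLaw_next (hsel : M.IsVGolf F G σ K β sel) (hk : k < K) (h : Fin M.H) :
    Measurable fun p : (Fin k → M.Epoch) × M.Epoch =>
      M.testLaw t (greedyPolicy σ (sel k p.1)) h (p.2 h).1 :=
  measurable_testLaw (π := fun p : (Fin k → M.Epoch) × M.Epoch => greedyPolicy σ (sel k p.1))
    (fun m hm => (hsel.measurable_policy k hk m (hm.trans h.2)).comp
      (measurable_fst.fst.prodMk measurable_snd))
    ((measurable_pi_apply h).comp measurable_snd).fst

theorem isProbabilityMeasure_testLaw_next (hsel : M.IsVGolf F G σ K β sel)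
    (ha : M.Admissible F G σ) (hk : k < K) (D : Fin k → M.Epoch) (h : Fin M.H) (s : S) :
    IsProbabilityMeasure (M.testLaw t (greedyPolicy σ (sel k D)) h s) :=
  isProbabilityMeasure_testLaw
    (fun _ hm => hsel.measurable_greedyPolicy ha hk D (hm.trans h.2)) s

theorem isProbabilityMeasure_pastTestLaw (hsel : M.IsVGolf F G σ K β sel)
    (ha : M.Admissible F G σ) (hk : k ≤ K) (D : Fin k → M.Epoch) (h : Fin M.H) (i : Fin k) :
    IsProbabilityMeasure (M.pastTestLaw t σ sel D h i) :=
  hsel.isProbabilityMeasure_testLaw_next ha (i.2.trans_le hk) _ h _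

theorem measurable_residual_uncurry [Finite A] (hsel : M.IsVGolf F G σ K β sel) (hk : k < K)
    {h : ℕ} (hh : h < M.H) :
    Measurable (Function.uncurry fun D : Fin k → M.Epoch => M.residual σ (sel k D) h) := by
  have hvalue (m : ℕ) :
      Measurable fun p : (Fin k → M.Epoch) × S × A => sel k p.1 m p.2.1 p.2.2 := by
    by_cases hm : m < M.H
    · exact hsel.measurable_value k hk m hm
    · simp only [fun D => (hsel.mem k hk D).2 m (by omega), Pi.zero_apply]
      exact measurable_const
  have hgreedy : Measurable fun p : (Fin k → M.Epoch) × S => (p.1, p.2, σ h (sel k p.1 h) p.2) :=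
    measurable_fst.prodMk (measurable_snd.prodMk (hsel.measurable_policy k hk h hh))
  exact ((hvalue h).comp hgreedy).sub ((measurable_bellman_uncurry (M := M) (h := h)
    (g := fun D : Fin k → M.Epoch => sel k D (h + 1)) (hvalue (h + 1))).comp hgreedy)

end Measurability

theorem ae_reward_mem [Finite A] [Nonempty A] [MeasurableSingletonClass A]
    (hsel : M.IsVGolf F G σ K β sel) (ha : M.Admissible F G σ) :
    ∀ᵐ D ∂M.dataLaw σ sel K, ∀ i h, (D i h).2.2.1 ∈ Set.Icc (0 : ℝ) 1 := by
  have hset : MeasurableSet {e : M.Epoch | ∀ h, (e h).2.2.1 ∈ Set.Icc (0 : ℝ) 1} := by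
    simp_rw [Set.ofPred_forall]
    refine .iInter fun h => ?_
    have hreward : Measurable fun e : M.Epoch => (e h).2.2.1 :=
      (measurable_pi_apply h).snd.snd.fst
    exact hreward measurableSet_Icc
  rw [dataLaw_eq_adaptiveLaw]
  exact (hsel.isAdaptiveSampling ha).ae_forall_mem hset fun k hk D =>
    ae_reward_mem_epochLaw (fun _ hm => hsel.measurable_greedyPolicy ha hk D hm)
      fun _ hm => ha.reward_le hm

section GoodEvent

variable [Fintype A] [Nonempty A] {θ ρ : ℝ}

theorem sel_mem_confidenceSet_of_isConcentrated (hsel : M.IsVGolf F G σ K β sel)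
    (ha : M.Admissible F G σ) {W : Set (ℕ → S → A → ℝ)}
    (hW : IsCover (M.tuples F ∪ M.tuples G) W ρ) (hρ : 0 ≤ ρ) (hk : k < K)
    (hβ : 8 * θ + 16 * (K * ρ) ≤ β) {D : Fin k → M.Epoch}
    (hD : ∀ i h, (D i h).2.2.1 ∈ Set.Icc (0 : ℝ) 1) (hdev : M.IsConcentrated t σ sel W θ D) :
    sel k D ∈ M.confidenceSet F G β D ∧
      actionMax (M.optimalQ 0) M.s₁ ≤ actionMax (sel k D 0) M.s₁ := by
  have hkρ : k * ρ ≤ K * ρ := by gcongr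
  have hQ := ha.optimalQ_mem_confidenceSet hW hD hρ (fun h w hw => (hdev h w hw).2)
    (by linarith : 8 * θ + 16 * (k * ρ) ≤ β)
  obtain ⟨hmem, hmax⟩ := hsel.argmax k hk D ⟨_, hQ⟩
  refine ⟨hmem, ?_⟩
  rw [ha.actionMax_eq ha.optimalQ_mem M.H_pos, ha.actionMax_eq (hsel.mem k hk D) M.H_pos]
  exact hmax _ hQ

theorem pastSqError_le_of_isConcentrated (hsel : M.IsVGolf F G σ K β sel)
    (ha : M.Admissible F G σ) {W : Set (ℕ → S → A → ℝ)}
    (hW : IsCover (M.tuples F ∪ M.tuples G) W ρ) (hρ : 0 ≤ ρ) (hk : k < K) {D : Fin k → M.Epoch}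
    (hD : ∀ i h, (D i h).2.2.1 ∈ Set.Icc (0 : ℝ) 1) (hdev : M.IsConcentrated t σ sel W θ D)
    (hmem : sel k D ∈ M.confidenceSet F G β D) (h : Fin M.H) :
    M.pastSqError t σ sel D h ≤ Fintype.card A * (32 * θ + 4 * β + 72 * (K * ρ)) := by
  have := hsel.isProbabilityMeasure_pastTestLaw (t := t) ha hk.le D h
  refine (ha.sum_sq_integral_residual_le hW (fun i => hD i h)
    (fun w hw => (hdev h w hw).1) hmem).trans ?_
  gcongr

variable [MeasurableSingletonClass A]

theorem measure_lt_deviation_le (hsel : M.IsVGolf F G σ K β sel) (ha : M.Admissible F G σ)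
    (hk : k ≤ K) (h : Fin M.H) {ξ ζ : S → A → ℝ} (hξ : UnitValued ξ) (hζ : UnitValued ζ) :
    M.dataLaw σ sel K {D | θ < M.deviation (M.pastTestLaw t σ sel (Fin.take k hk D) h) h ξ ζ
      (Fin.take k hk D)} ≤ ENNReal.ofReal (Real.exp (-θ)) := by
  rw [dataLaw_eq_adaptiveLaw]
  refine le_trans (measure_mono (Set.ofPred_subset_ofPred.2 fun D hD => le_of_lt hD))
    ((hsel.isAdaptiveSampling ha).measure_le_predictableSum_le
      (w := fun k D e => M.testIncrement t (greedyPolicy σ (sel k D)) h ξ ζ (e h))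
      (fun k hk => ?_) (fun k hk D => ?_) θ hk)
  · exact measurable_testIncrement (π := fun p : (Fin k → M.Epoch) × M.Epoch =>
      greedyPolicy σ (sel k p.1)) (fun m hm => (hsel.measurable_policy k hk m (hm.trans h.2)).comp
        (measurable_fst.fst.prodMk measurable_snd)) hξ hζ
      ((measurable_pi_apply h).comp measurable_snd)
  · have hπ (m : ℕ) (hm : m < M.H) := hsel.measurable_greedyPolicy ha hk D hm
    have hinc : Measurable fun z => M.testIncrement t (greedyPolicy σ (sel k D)) h ξ ζ z :=
      measurable_testIncrement (π := fun _ => greedyPolicy σ (sel k D))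
        (fun m hm => (hπ m (hm.trans h.2)).comp measurable_snd) hξ hζ measurable_id
    exact (M.lintegral_epochLaw_eval hπ h hinc.exp.ennreal_ofReal).trans_le
      (lintegral_exp_testIncrement_le (fun m hm => hπ m (hm.trans h.2))
        (fun s a => ha.reward_le h.2 s a) hξ hζ)

theorem measure_not_isConcentrated_take_le (hsel : M.IsVGolf F G σ K β sel)
    (ha : M.Admissible F G σ) (hk : k ≤ K) {W : Finset (ℕ → S → A → ℝ)}
    (hW : (W : Set (ℕ → S → A → ℝ)) ⊆ M.tuples F ∪ M.tuples G) :
    M.dataLaw σ sel K {D | ¬ M.IsConcentrated t σ sel W θ (Fin.take k hk D)} ≤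
      M.H * (W.card * (2 * ENNReal.ofReal (Real.exp (-θ)))) := by
  set bad : Fin M.H → (S → A → ℝ) → (S → A → ℝ) → Set (Fin K → M.Epoch) := fun h ξ ζ =>
    {D | θ < M.deviation (M.pastTestLaw t σ sel (Fin.take k hk D) h) h ξ ζ (Fin.take k hk D)}
  have hsub : {D | ¬ M.IsConcentrated t σ sel W θ (Fin.take k hk D)} ⊆
      ⋃ h, ⋃ w ∈ W, bad h (w h) (w (h + 1)) ∪ bad h (w h) (M.optimalQ (h + 1)) := by
    intro D hD
    simp only [IsConcentrated, Set.mem_ofPred_eq, not_forall, not_and_or, not_le] at hD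
    obtain ⟨h, w, hw, hD⟩ := hD
    exact Set.mem_iUnion.2 ⟨h, Set.mem_biUnion hw hD⟩
  have hQ := ha.isValueClass.unitValued ha.optimalQ_mem
  refine (measure_mono hsub).trans ((measure_iUnion_fintype_le _ _).trans ?_)
  refine (Finset.sum_le_card_nsmul _ _ (W.card * (2 * ENNReal.ofReal (Real.exp (-θ))))
    fun h _ => (measure_biUnion_finset_le _ _).trans ?_).trans_eq (by simp)
  refine (Finset.sum_le_card_nsmul _ _ (2 * ENNReal.ofReal (Real.exp (-θ)))
    fun w hw => ?_).trans_eq (by simp)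
  have hwU := ha.unitValued_of_mem_union (hW hw)
  rw [two_mul]
  exact (measure_union_le _ _).trans (add_le_add
    (hsel.measure_lt_deviation_le ha hk h (hwU h) (hwU (h + 1)))
    (hsel.measure_lt_deviation_le ha hk h (hwU h) (hQ (h + 1))))

theorem measure_not_forall_isConcentrated_le (hsel : M.IsVGolf F G σ K β sel)
    (ha : M.Admissible F G σ) {W : Finset (ℕ → S → A → ℝ)}
    (hW : (W : Set (ℕ → S → A → ℝ)) ⊆ M.tuples F ∪ M.tuples G) :
    M.dataLaw σ sel K {D | ¬ ∀ k : Fin K, M.IsConcentrated t σ sel W θ (Fin.take k k.2.le D)} ≤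
      ENNReal.ofReal (2 * (K * M.H * W.card) * Real.exp (-θ)) := by
  simp only [not_forall, Set.ofPred_exists]
  refine (measure_iUnion_fintype_le _ _).trans ((Finset.sum_le_card_nsmul _ _ _
    fun k _ => hsel.measure_not_isConcentrated_take_le ha k.2.le hW).trans_eq ?_)
  rw [ENNReal.ofReal_mul (by positivity)]
  simp [ENNReal.ofReal_mul, mul_assoc, mul_left_comm]

end GoodEvent

end IsVGolf

end MDP

/-! ### Error of the output policy -/

section RandomIndex

variable {X : Type*} [MeasurableSpace X] {μ : Measure X}

theorem lintegral_prod_uniformOn_univ {Y : Type*} [MeasurableSpace Y] [MeasurableSingletonClass Y]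
    [Fintype Y] {f : X × Y → ℝ≥0∞} (hf : Measurable f) :
    ∫⁻ z, f z ∂μ.prod (uniformOn (Set.univ : Set Y)) =
      (Fintype.card Y : ℝ≥0∞)⁻¹ * ∑ y, ∫⁻ x, f (x, y) ∂μ := by
  have hsection (y : Y) : Measurable fun x => f (x, y) := hf.comp measurable_prodMk_right
  rw [lintegral_prod _ hf.aemeasurable]
  simp_rw [lintegral_uniformOn_univ]
  rw [lintegral_const_mul _ (Finset.measurable_sum _ fun y _ => hsection y),
    lintegral_finsetSum _ fun y _ => hsection y]

theorem le_measure_of_lintegral_le [IsProbabilityMeasure μ] {good bad : Set X} {f : X → ℝ≥0∞}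
    {δ η : ℝ} (hf : Measurable f) (hδ : 0 ≤ δ) (hη : 0 < η) (hbad : μ bad ≤ ENNReal.ofReal δ)
    (hlintegral : ∫⁻ x, f x ∂μ ≤ ENNReal.ofReal (δ * η))
    (hgood : ∀ x, x ∉ bad → f x < ENNReal.ofReal η → x ∈ good) :
    ENNReal.ofReal (1 - 2 * δ) ≤ μ good := by
  have hlarge : μ {x | ENNReal.ofReal η ≤ f x} ≤ ENNReal.ofReal δ := by
    refine (meas_ge_le_lintegral_div hf.aemeasurable (by simpa using hη)
      ENNReal.ofReal_ne_top).trans ((ENNReal.div_le_div_right hlintegral _).trans_eq ?_)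
    rw [← ENNReal.ofReal_div_of_pos hη, mul_div_cancel_right₀ _ hη.ne']
  have hcover : Set.univ ⊆ good ∪ (bad ∪ {x | ENNReal.ofReal η ≤ f x}) := fun x _ => by
    by_cases hb : x ∈ bad
    · exact Or.inr (Or.inl hb)
    · exact (lt_or_ge (f x) (ENNReal.ofReal η)).imp (hgood x hb) Or.inr
  have htotal : 1 ≤ μ good + ENNReal.ofReal (2 * δ) := calc
    1 = μ Set.univ := measure_univ.symm
    _ ≤ μ good + μ (bad ∪ {x | ENNReal.ofReal η ≤ f x}) :=
      (measure_mono hcover).trans (measure_union_le _ _)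
    _ ≤ μ good + (ENNReal.ofReal δ + ENNReal.ofReal δ) :=
      add_le_add le_rfl ((measure_union_le _ _).trans (add_le_add hbad hlarge))
    _ = μ good + ENNReal.ofReal (2 * δ) := by rw [← ENNReal.ofReal_add hδ hδ, two_mul]
  rw [ENNReal.ofReal_sub _ (by linarith), ENNReal.ofReal_one]
  exact tsub_le_iff_right.2 htotal

end RandomIndex

theorem sum_castLE_eq_sum_Iio {K : ℕ} {R : Type*} [AddCommMonoid R] (k : Fin K) (f : Fin K → R) :
    ∑ i : Fin k, f (Fin.castLE k.2.le i) = ∑ i ∈ Finset.Iio k, f i :=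
  Finset.sum_bij (fun i _ => Fin.castLE k.2.le i)
    (fun i _ => Finset.mem_Iio.2 (Fin.lt_def.2 i.2))
    (fun _ _ _ _ h => Fin.castLE_injective _ h)
    (fun i hi => ⟨⟨i, Fin.lt_def.1 (Finset.mem_Iio.1 hi)⟩, Finset.mem_univ _, rfl⟩)
    fun _ _ => rfl

namespace MDP

section Definitions

variable {S A : Type*} [MeasurableSpace S] [MeasurableSpace A]

/-- The families of state distributions in which the test distributions of kind `t` lie. -/
def testFamily (M : MDP S A) (F : ℕ → Set (S → A → ℝ)) (σ : ℕ → (S → A → ℝ) → S → A) :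
    TestKind → ℕ → Set (Measure S)
  | .pointMass => diracLaws S
  | .rollIn => M.rollInLaws F σ

open Classical in
/-- Mean residual, at step `h` and on the test distribution of the epoch with data `e`, of the
function chosen after the data `D`. It is replaced by `0` unless that function has squared error at
most `Γ` on the past, so that the pigeonhole bound of the Eluder dimension applies on every run. -/
def stepError (M : MDP S A) (t : TestKind) (σ : ℕ → (S → A → ℝ) → S → A)
    (sel : (k : ℕ) → (Fin k → M.Epoch) → ℕ → S → A → ℝ) (Γ : ℝ) (h : Fin M.H) {k : ℕ}
    (D : Fin k → M.Epoch) (e : M.Epoch) : ℝ≥0∞ :=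
  if M.pastSqError t σ sel D h ≤ Γ then
    ‖∫ s, M.residual σ (sel k D) h s ∂M.testLaw t (greedyPolicy σ (sel k D)) h (e h).1‖ₑ
  else 0

/-- Expected sum of the step errors of the epoch that follows the data `D`. -/
def meanError (M : MDP S A) (t : TestKind) (σ : ℕ → (S → A → ℝ) → S → A)
    (sel : (k : ℕ) → (Fin k → M.Epoch) → ℕ → S → A → ℝ) (Γ : ℝ) {k : ℕ} (D : Fin k → M.Epoch) :
    ℝ≥0∞ :=
  ∑ h, ∫⁻ e, M.stepError t σ sel Γ h D e ∂M.nextEpochLaw σ sel k D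

end Definitions

namespace IsVGolf

variable {S A : Type*} [MeasurableSpace S] [MeasurableSpace A] {M : MDP S A}
  {F G : ℕ → Set (S → A → ℝ)} {σ : ℕ → (S → A → ℝ) → S → A} {K k : ℕ} {β Γ ε η : ℝ} {d : ℕ}
  {sel : (k : ℕ) → (Fin k → M.Epoch) → ℕ → S → A → ℝ} {t : TestKind}

theorem pastTestLaw_mem_testFamily (hsel : M.IsVGolf F G σ K β sel) (D : Fin K → M.Epoch)
    (h : Fin M.H) (k : Fin K) : M.pastTestLaw t σ sel D h k ∈ M.testFamily F σ t h := by
  cases t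
  · exact ⟨_, rfl⟩
  · exact ⟨_, hsel.mem k k.2 _, rfl⟩

theorem measurable_integral_residual_testLaw [Finite A] (hsel : M.IsVGolf F G σ K β sel)
    (ha : M.Admissible F G σ) (hk : k < K) (h : Fin M.H) :
    Measurable fun p : (Fin k → M.Epoch) × M.Epoch => ∫ s, M.residual σ (sel k p.1) h s
      ∂M.testLaw t (greedyPolicy σ (sel k p.1)) h (p.2 h).1 :=
  have (p : (Fin k → M.Epoch) × M.Epoch) :=
    hsel.isProbabilityMeasure_testLaw_next (t := t) ha hk p.1 h (p.2 h).1
  measurable_integral_of_family (hsel.measurable_testLaw_next hk h)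
    (g := fun (p : (Fin k → M.Epoch) × M.Epoch) => M.residual σ (sel k p.1) h)
    ((hsel.measurable_residual_uncurry hk h.2).comp (measurable_fst.fst.prodMk measurable_snd))

theorem measurable_pastSqError [Finite A] (hsel : M.IsVGolf F G σ K β sel)
    (ha : M.Admissible F G σ) (hk : k < K) (h : Fin M.H) :
    Measurable fun D : Fin k → M.Epoch => M.pastSqError t σ sel D h := by
  refine Finset.measurable_sum _ fun i _ => Measurable.pow_const ?_ 2
  have (D : Fin k → M.Epoch) := hsel.isProbabilityMeasure_pastTestLaw (t := t) ha hk.le D h i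
  have hdata : Measurable fun D : Fin k → M.Epoch => (Fin.take i i.2.le D, D i) :=
    (measurable_take i.2.le).prodMk (measurable_pi_apply i)
  have hlaw : Measurable fun D : Fin k → M.Epoch => M.pastTestLaw t σ sel D h i := by
    have hnext := (hsel.measurable_testLaw_next (t := t) (i.2.trans hk) h).comp hdata
    exact hnext
  exact measurable_integral_of_family hlaw (hsel.measurable_residual_uncurry hk h.2)

theorem measurable_stepError [Finite A] (hsel : M.IsVGolf F G σ K β sel)
    (ha : M.Admissible F G σ) (hk : k < K) (h : Fin M.H) :
    Measurable (Function.uncurry fun D : Fin k → M.Epoch => M.stepError t σ sel Γ h D) :=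
  Measurable.ite (measurable_fst (measurableSet_le (hsel.measurable_pastSqError ha hk h)
    measurable_const)) (hsel.measurable_integral_residual_testLaw ha hk h).enorm measurable_const

theorem sum_stepError_le (hsel : M.IsVGolf F G σ K β sel) (ha : M.Admissible F G σ) (hε : 0 < ε)
    (hΓ : 0 ≤ Γ) (hd : M.dimVBE F σ (M.testFamily F σ t) ε ≤ d) (h : Fin M.H)
    (D : Fin K → M.Epoch) :
    ∑ k : Fin K, M.stepError t σ sel Γ h (Fin.take k k.2.le D) (D k) ≤
      ENNReal.ofReal (ε * K + d + 2 * √(d * Γ * K)) := by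
  classical
  set φ := fun k : Fin K => M.residual σ (sel k (Fin.take k k.2.le D)) h
  set ν := M.pastTestLaw t σ sel D h
  set I : Finset (Fin K) := {k | M.pastSqError t σ sel (Fin.take k k.2.le D) h ≤ Γ}
  have hmem (k : Fin K) : sel k (Fin.take k k.2.le D) ∈ M.tuples F := hsel.mem k k.2 _
  have := hsel.isProbabilityMeasure_pastTestLaw (t := t) ha le_rfl D h
  have hcard : (I.card : ℝ) ≤ K := by
    exact_mod_cast (Finset.card_le_univ _).trans_eq (Fintype.card_fin K)
  have hbound : ∑ k ∈ I, |∫ s, φ k s ∂ν k| ≤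
      ε * I.card + d + 2 * √(d * Γ * I.card) := by
    refine sum_abs_integral_le_of_dimDE_le ((le_iSup (fun h : Fin M.H =>
      dimDE (M.residualClass F σ h) (M.testFamily F σ t h) ε) h).trans hd) hε hΓ
      (fun k _ => hsel.pastTestLaw_mem_testFamily D h k) (fun k _ => ⟨_, hmem k, rfl⟩)
      (fun k hk => ?_) fun k _ => ?_
    · have hpast : ∑ i ∈ Finset.Iio k, (∫ s, φ k s ∂ν i) ^ 2 ≤ Γ :=
        (sum_castLE_eq_sum_Iio k _).symm.trans_le (Finset.mem_filter.1 hk).2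
      refine (Finset.sum_le_sum_of_subset_of_nonneg (fun i hi => ?_)
        fun _ _ _ => sq_nonneg _).trans hpast
      exact Finset.mem_Iio.2 (Finset.mem_filter.1 hi).2
    · simpa using norm_integral_le_of_norm_le_const (μ := ν k) (f := φ k)
        (.of_forall (ha.abs_residual_le_one (hmem k) h.2))
  refine le_trans (le_of_eq ?_) (ENNReal.ofReal_le_ofReal (hbound.trans (by gcongr)))
  rw [ENNReal.ofReal_sum_of_nonneg fun _ _ => abs_nonneg _, Finset.sum_filter]
  simp only [← Real.enorm_eq_ofReal_abs]
  rfl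

section ExpectedError

variable [Finite A] [Nonempty A] [MeasurableSingletonClass A]

theorem measurable_lintegral_stepError (hsel : M.IsVGolf F G σ K β sel) (ha : M.Admissible F G σ)
    (hk : k < K) (h : Fin M.H) : Measurable fun D : Fin k → M.Epoch =>
      ∫⁻ e, M.stepError t σ sel Γ h D e ∂M.nextEpochLaw σ sel k D :=
  have (D : Fin k → M.Epoch) := (hsel.isAdaptiveSampling ha).isProbabilityMeasure k hk D
  measurable_lintegral_of_family ((hsel.isAdaptiveSampling ha).measurable k hk)
    (hsel.measurable_stepError ha hk h)

theorem measurable_meanError_take (hsel : M.IsVGolf F G σ K β sel) (ha : M.Admissible F G σ) :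
    Measurable fun x : (Fin K → M.Epoch) × Fin K =>
      M.meanError t σ sel Γ (Fin.take x.2 x.2.2.le x.1) :=
  measurable_from_prod_countable_left fun k => (Finset.measurable_sum _ fun h _ =>
    hsel.measurable_lintegral_stepError ha k.2 h).comp (measurable_take k.2.le)

theorem lintegral_meanError (hsel : M.IsVGolf F G σ K β sel) (ha : M.Admissible F G σ)
    (k : Fin K) :
    ∫⁻ D, M.meanError t σ sel Γ (Fin.take k k.2.le D) ∂M.dataLaw σ sel K =
      ∑ h, ∫⁻ D, M.stepError t σ sel Γ h (Fin.take k k.2.le D) (D k) ∂M.dataLaw σ sel K := by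
  rw [dataLaw_eq_adaptiveLaw]
  refine (lintegral_finsetSum _ fun h _ => (hsel.measurable_lintegral_stepError ha k.2 h).comp
    (measurable_take k.2.le)).trans (Finset.sum_congr rfl fun h _ => ?_)
  exact ((hsel.isAdaptiveSampling ha).lintegral_next k.2
    (hsel.measurable_stepError ha k.2 h)).symm

theorem isProbabilityMeasure_dataLaw (hsel : M.IsVGolf F G σ K β sel)
    (ha : M.Admissible F G σ) : IsProbabilityMeasure (M.dataLaw σ sel K) := by
  rw [dataLaw_eq_adaptiveLaw]
  exact (hsel.isAdaptiveSampling ha).isProbabilityMeasure_adaptiveLaw K le_rfl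

theorem sum_lintegral_meanError_le (hsel : M.IsVGolf F G σ K β sel) (ha : M.Admissible F G σ)
    (hε : 0 < ε) (hΓ : 0 ≤ Γ) (hd : M.dimVBE F σ (M.testFamily F σ t) ε ≤ d) :
    ∑ k : Fin K, ∫⁻ D, M.meanError t σ sel Γ (Fin.take k k.2.le D) ∂M.dataLaw σ sel K ≤
      ENNReal.ofReal (M.H * (ε * K + d + 2 * √(d * Γ * K))) := by
  have := hsel.isProbabilityMeasure_dataLaw ha
  have hnext (k : Fin K) (h : Fin M.H) : Measurable fun D : Fin K → M.Epoch =>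
      M.stepError t σ sel Γ h (Fin.take k k.2.le D) (D k) :=
    have hdata : Measurable fun D : Fin K → M.Epoch => (Fin.take k k.2.le D, D k) :=
      (measurable_take k.2.le).prodMk (measurable_pi_apply k)
    have hstep := (hsel.measurable_stepError (t := t) (Γ := Γ) ha k.2 h).comp hdata
    hstep
  simp_rw [hsel.lintegral_meanError ha]
  rw [Finset.sum_comm, ENNReal.ofReal_mul (Nat.cast_nonneg _), ENNReal.ofReal_natCast]
  refine (Finset.sum_le_card_nsmul _ _ _ fun h _ => ?_).trans_eq
    (by rw [Finset.card_univ, Fintype.card_fin, nsmul_eq_mul])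
  rw [← lintegral_finsetSum _ fun k _ => hnext k h]
  exact (lintegral_mono (hsel.sum_stepError_le ha hε hΓ hd h)).trans_eq (by simp)

theorem lintegral_meanError_prod_uniformOn_le (hsel : M.IsVGolf F G σ K β sel)
    (ha : M.Admissible F G σ) (hε : 0 < ε) (hΓ : 0 ≤ Γ)
    (hd : M.dimVBE F σ (M.testFamily F σ t) ε ≤ d) (hK : 0 < K)
    (herr : M.H * (ε * K + d + 2 * √(d * Γ * K)) ≤ K * η) :
    ∫⁻ x, M.meanError t σ sel Γ (Fin.take x.2 x.2.2.le x.1)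
      ∂(M.dataLaw σ sel K).prod (uniformOn (Set.univ : Set (Fin K))) ≤ ENNReal.ofReal η := by
  rw [lintegral_prod_uniformOn_univ (hsel.measurable_meanError_take ha), Fintype.card_fin,
    ENNReal.inv_mul_le_iff (by positivity) (by simp), ← ENNReal.ofReal_natCast,
    ← ENNReal.ofReal_mul K.cast_nonneg]
  exact (hsel.sum_lintegral_meanError_le ha hε hΓ hd).trans (ENNReal.ofReal_le_ofReal herr)

end ExpectedError

theorem enorm_integral_residual_le [Finite A] [Nonempty A] [MeasurableSingletonClass A]
    (hsel : M.IsVGolf F G σ K β sel) (ha : M.Admissible F G σ) (t : TestKind) (hk : k < K)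
    (D : Fin k → M.Epoch) (h : Fin M.H) :
    ‖∫ s, M.residual σ (sel k D) h s ∂M.stateLaw (greedyPolicy σ (sel k D)) 0 M.s₁ h‖ₑ ≤
      ∫⁻ e, ‖∫ s, M.residual σ (sel k D) h s
        ∂M.testLaw t (greedyPolicy σ (sel k D)) h (e h).1‖ₑ ∂M.nextEpochLaw σ sel k D := by
  cases nonempty_fintype A
  have hf := hsel.mem k hk D
  have hm := ha.measurable_residual hf h.2
  have hπ (m : ℕ) (hm : m < M.H) := hsel.measurable_greedyPolicy ha hk D hm
  have := M.isProbabilityMeasure_epochLaw hπ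
  cases t
  · simp only [testLaw, integral_dirac' _ _ hm.stronglyMeasurable]
    refine (enorm_integral_le_lintegral_enorm _).trans_eq ?_
    rw [nextEpochLaw, M.lintegral_epochLaw_eval hπ h
      (F := fun z => ‖M.residual σ (sel k D) h z.1‖ₑ) (hm.enorm.comp measurable_fst)]
    exact (M.lintegral_tupleLaw_fst hm.enorm).symm
  · simp [testLaw, nextEpochLaw]

theorem ofReal_gap_le_meanError [Finite A] [Nonempty A] [MeasurableSingletonClass A]
    (hsel : M.IsVGolf F G σ K β sel) (ha : M.Admissible F G σ) (hk : k < K)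
    {D : Fin k → M.Epoch} (hopt : actionMax (M.optimalQ 0) M.s₁ ≤ actionMax (sel k D 0) M.s₁)
    (hpast : ∀ h, M.pastSqError t σ sel D h ≤ Γ) :
    ENNReal.ofReal (M.Vstar 0 M.s₁ - M.V (greedyPolicy σ (sel k D)) 0 M.s₁) ≤
      M.meanError t σ sel Γ D := by
  have hgap : M.Vstar 0 M.s₁ - M.V (greedyPolicy σ (sel k D)) 0 M.s₁ ≤ ∑ h : Fin M.H,
      |∫ s, M.residual σ (sel k D) h s ∂M.stateLaw (greedyPolicy σ (sel k D)) 0 M.s₁ h| := calc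
    _ ≤ actionMax (sel k D 0) M.s₁ - M.V (greedyPolicy σ (sel k D)) 0 M.s₁ :=
      sub_le_sub_right (ha.Vstar_le.trans hopt) _
    _ = ∑ h : Fin M.H,
        ∫ s, M.residual σ (sel k D) h s ∂M.stateLaw (greedyPolicy σ (sel k D)) 0 M.s₁ h := by
      rw [ha.actionMax_sub_V_greedyPolicy (hsel.mem k hk D) M.H.zero_le]
      simp [Finset.sum_range]
    _ ≤ _ := Finset.sum_le_sum fun _ _ => le_abs_self _
  refine (ENNReal.ofReal_le_ofReal hgap).trans ?_
  rw [ENNReal.ofReal_sum_of_nonneg fun _ _ => abs_nonneg _]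
  refine Finset.sum_le_sum fun h _ => ?_
  simp only [stepError, if_pos (hpast h), ← Real.enorm_eq_ofReal_abs]
  exact hsel.enorm_integral_residual_le ha t hk D h

section Output

variable [Fintype A] [Nonempty A] [MeasurableSingletonClass A] {θ ρ δ : ℝ}

theorem ofReal_sub_V_le_meanError_of_isConcentrated (hsel : M.IsVGolf F G σ K β sel)
    (ha : M.Admissible F G σ) {W : Set (ℕ → S → A → ℝ)}
    (hW : IsCover (M.tuples F ∪ M.tuples G) W ρ) (hρ : 0 ≤ ρ) (hk : k < K)
    (hβ : 8 * θ + 16 * (K * ρ) ≤ β) {D : Fin k → M.Epoch}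
    (hD : ∀ i h, (D i h).2.2.1 ∈ Set.Icc (0 : ℝ) 1) (hdev : M.IsConcentrated t σ sel W θ D) :
    ENNReal.ofReal (M.Vstar 0 M.s₁ - M.V (greedyPolicy σ (sel k D)) 0 M.s₁) ≤
      M.meanError t σ sel (Fintype.card A * (32 * θ + 4 * β + 72 * (K * ρ))) D := by
  obtain ⟨hmem, hopt⟩ := hsel.sel_mem_confidenceSet_of_isConcentrated ha hW hρ hk hβ hD hdev
  exact hsel.ofReal_gap_le_meanError ha hk hopt
    (hsel.pastSqError_le_of_isConcentrated ha hW hρ hk hD hdev hmem)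

theorem ofReal_one_sub_le_outputProb (hsel : M.IsVGolf F G σ K β sel) (ha : M.Admissible F G σ)
    (hε : 0 < ε) (hd : M.dimVBE F σ (M.testFamily F σ t) ε ≤ d) {W : Finset (ℕ → S → A → ℝ)}
    (hW : IsCover (M.tuples F ∪ M.tuples G) W ρ) (hρ : 0 ≤ ρ) (hθ : 0 ≤ θ)
    (hβ : 8 * θ + 16 * (K * ρ) ≤ β) (hK : 0 < K) (hη : 0 < η) (hδ : 0 ≤ δ)
    (hfail : 2 * (K * M.H * W.card) * Real.exp (-θ) ≤ δ)
    (herr : M.H * (ε * K + d + 2 * √(d * (Fintype.card A * (32 * θ + 4 * β + 72 * (K * ρ))) * K)) ≤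
      K * (δ * η)) :
    ENNReal.ofReal (1 - 2 * δ) ≤ M.outputProb σ sel K (M.IsOptimalUpTo η) := by
  have hKρ : 0 ≤ K * ρ := by positivity
  have hΓ : 0 ≤ Fintype.card A * (32 * θ + 4 * β + 72 * (K * ρ)) :=
    mul_nonneg (Nat.cast_nonneg _) (by linarith)
  have := hsel.isProbabilityMeasure_dataLaw ha
  have : Nonempty (Fin K) := ⟨⟨0, hK⟩⟩
  set bad : Set (Fin K → M.Epoch) :=
    {D | ¬ ∀ k : Fin K, M.IsConcentrated t σ sel W θ (Fin.take k k.2.le D)} ∪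
      {D | ¬ ∀ i h, (D i h).2.2.1 ∈ Set.Icc (0 : ℝ) 1}
  have hbad : M.dataLaw σ sel K bad ≤ ENNReal.ofReal δ := by
    refine (measure_union_le _ _).trans ?_
    rw [ae_iff.1 (hsel.ae_reward_mem ha), add_zero]
    exact (hsel.measure_not_forall_isConcentrated_le ha hW.1).trans (ENNReal.ofReal_le_ofReal hfail)
  refine le_measure_of_lintegral_le (bad := bad ×ˢ Set.univ) (hsel.measurable_meanError_take ha)
    hδ hη (by simpa using hbad) (hsel.lintegral_meanError_prod_uniformOn_le ha hε hΓ hd hK herr) ?_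
  rintro ⟨D, k⟩ hgood hsmall
  simp only [bad, Set.mem_prod, Set.mem_univ, and_true, Set.mem_union, not_or, Set.mem_ofPred_eq,
    not_not] at hgood
  have hgap := (hsel.ofReal_sub_V_le_meanError_of_isConcentrated ha hW hρ k.2 hβ
    (fun i => hgood.2 (Fin.castLE k.2.le i)) (hgood.1 k)).trans_lt hsmall
  exact sub_le_comm.1 ((ENNReal.ofReal_lt_ofReal_iff hη).1 hgap).le

end Output

end IsVGolf

end MDP

/-! ### Rates -/

section Rates

variable {H d a N K : ℕ} {ε : ℝ}

theorem sampleSize_eq : sampleSize H d a N ε =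
    (scale H d a ε)⁻¹ * Real.log (N * ((H : ℝ) * d * a / ε)) := by
  rw [scale, inv_div, sampleSize]

theorem two_mul_mul_exp_neg_ten_mul_log_le {x : ℝ} (hx : 3 ≤ x) :
    2 * x * Real.exp (-(10 * Real.log x)) ≤ 0.005 := by
  have hx0 : 0 < x := by linarith
  have hexp : Real.exp (-(10 * Real.log x)) = (x ^ 10)⁻¹ := by
    rw [Real.exp_neg, ← Real.exp_log (pow_pos hx0 10), Real.log_pow]
    norm_num
  rw [hexp, ← div_eq_mul_inv, div_le_iff₀ (by positivity)]
  have hpow : (3 : ℝ) ^ 9 ≤ x ^ 9 := pow_le_pow_left₀ (by norm_num) hx 9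
  nlinarith

/-- `K` epochs suffice for accuracy `ε < 1/3`, with horizon `H`, dimension `d`, `a` actions and
covering number `N`, all positive. -/
structure IsLargeSample (H d a N K : ℕ) (ε : ℝ) : Prop where
  horizon_pos : 0 < H
  dim_pos : 0 < d
  actions_pos : 0 < a
  cover_pos : 0 < N
  eps_pos : 0 < ε
  eps_lt : ε < 1 / 3
  sampleSize_le : sampleSize H d a N ε ≤ K

namespace IsLargeSample

theorem scale_pos (h : IsLargeSample H d a N K ε) : 0 < scale H d a ε := by
  obtain ⟨hH, hd, ha, -, hε, -, -⟩ := h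
  unfold scale
  positivity

theorem three_mul_le (h : IsLargeSample H d a N K ε) :
    3 * (H * N * (d * a)) ≤ N * ((H : ℝ) * d * a / ε) := by
  rw [← mul_div_assoc, le_div_iff₀ h.eps_pos]
  have : (0 : ℝ) ≤ H * N * (d * a) := by positivity
  nlinarith [h.eps_lt]

theorem three_mul_horizon_mul_cover_le (h : IsLargeSample H d a N K ε) :
    3 * (H * N) ≤ N * ((H : ℝ) * d * a / ε) := by
  have hda : (1 : ℝ) ≤ d * a := by
    exact_mod_cast Nat.mul_pos h.dim_pos h.actions_pos
  have hHN : (0 : ℝ) ≤ H * N := by positivity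
  nlinarith [h.three_mul_le]

theorem three_le (h : IsLargeSample H d a N K ε) : 3 ≤ N * ((H : ℝ) * d * a / ε) := by
  have hHN : (1 : ℝ) ≤ H * N := by
    exact_mod_cast Nat.mul_pos h.horizon_pos h.cover_pos
  linarith [h.three_mul_horizon_mul_cover_le]

theorem log_le_mul_scale (h : IsLargeSample H d a N K ε) :
    Real.log (N * ((H : ℝ) * d * a / ε)) ≤ K * scale H d a ε := by
  have hK := h.sampleSize_le
  rwa [sampleSize_eq, inv_mul_le_iff₀ h.scale_pos, mul_comm (scale H d a ε)] at hK

theorem one_le_mul_scale (h : IsLargeSample H d a N K ε) : 1 ≤ K * scale H d a ε := by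
  refine le_trans ?_ h.log_le_mul_scale
  rw [Real.le_log_iff_exp_le (by linarith [h.three_le])]
  linarith [h.three_le, Real.exp_one_lt_three]

theorem inv_scale_le (h : IsLargeSample H d a N K ε) : (scale H d a ε)⁻¹ ≤ K := by
  rw [inv_le_iff_one_le_mul₀ h.scale_pos]
  exact h.one_le_mul_scale

theorem horizon_mul_dim_mul_actions_le (h : IsLargeSample H d a N K ε) :
    (H * d * a : ℝ) ≤ K * ε := by
  have hK := h.inv_scale_le
  have hε := h.eps_pos
  rw [scale, inv_div, div_le_iff₀ (by positivity)] at hK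
  have hH : (1 : ℝ) ≤ H := by exact_mod_cast h.horizon_pos
  calc (H * d * a : ℝ) ≤ H * (H * d * a) := le_mul_of_one_le_left (by positivity) hH
    _ = (H : ℝ) ^ 2 * d * a := by ring
    _ ≤ K * ε ^ 2 := hK
    _ ≤ K * ε := by gcongr; nlinarith [h.eps_lt]

theorem horizon_mul_dim_le (h : IsLargeSample H d a N K ε) : (H * d : ℝ) ≤ K * ε := by
  have ha : (1 : ℝ) ≤ a := by exact_mod_cast h.actions_pos
  exact (le_mul_of_one_le_right (by positivity) ha).trans h.horizon_mul_dim_mul_actions_le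

theorem le_mul_mul (h : IsLargeSample H d a N K ε) : N * ((H : ℝ) * d * a / ε) ≤ K * H * N := by
  have hH : (1 : ℝ) ≤ H := by exact_mod_cast h.horizon_pos
  have hdiv : (H : ℝ) * d * a / ε ≤ K := by
    rw [div_le_iff₀ h.eps_pos]
    exact h.horizon_mul_dim_mul_actions_le
  calc N * ((H : ℝ) * d * a / ε) ≤ N * K := by gcongr
    _ ≤ N * K * H := le_mul_of_one_le_right (by positivity) hH
    _ = K * H * N := by ring

theorem inv_scale_le_sq (h : IsLargeSample H d a N K ε) :
    (scale H d a ε)⁻¹ ≤ (N * ((H : ℝ) * d * a / ε)) ^ 2 := by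
  have hε := h.eps_pos
  have hNda : (1 : ℝ) ≤ N ^ 2 * (d * a) := by
    exact_mod_cast Nat.mul_pos (pow_pos h.cover_pos 2) (Nat.mul_pos h.dim_pos h.actions_pos)
  calc (scale H d a ε)⁻¹ = (H : ℝ) ^ 2 * d * a / ε ^ 2 := by rw [scale, inv_div]
    _ ≤ (H : ℝ) ^ 2 * d * a / ε ^ 2 * (N ^ 2 * (d * a)) :=
      le_mul_of_one_le_right (by positivity) hNda
    _ = (N * ((H : ℝ) * d * a / ε)) ^ 2 := by ring

theorem log_mul_mul_le (h : IsLargeSample H d a N K ε) :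
    Real.log (K * H * N) ≤ 4 * (K * scale H d a ε) := by
  have hs := h.scale_pos
  have hKs : 0 < K * scale H d a ε := zero_lt_one.trans_le h.one_le_mul_scale
  have hHN : (0 : ℝ) < H * N := by exact_mod_cast Nat.mul_pos h.horizon_pos h.cover_pos
  have hfactor : (K * H * N : ℝ) = K * scale H d a ε * ((scale H d a ε)⁻¹ * (H * N)) := by
    field_simp
  have hlogK : Real.log (K * scale H d a ε) ≤ K * scale H d a ε := by
    linarith [Real.log_le_sub_one_of_pos hKs]
  have hlogs : Real.log (scale H d a ε)⁻¹ ≤ 2 * Real.log (N * ((H : ℝ) * d * a / ε)) := by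
    refine (Real.log_le_log (inv_pos.2 hs) h.inv_scale_le_sq).trans_eq ?_
    rw [Real.log_pow, Nat.cast_ofNat]
  have hlogHN : Real.log (H * N) ≤ Real.log (N * ((H : ℝ) * d * a / ε)) :=
    Real.log_le_log hHN (by linarith [h.three_mul_horizon_mul_cover_le])
  rw [hfactor, Real.log_mul hKs.ne' (by positivity), Real.log_mul (by positivity) hHN.ne']
  linarith [h.log_le_mul_scale]

theorem three_le_mul_mul (h : IsLargeSample H d a N K ε) : (3 : ℝ) ≤ K * H * N :=
  h.three_le.trans h.le_mul_mul

theorem log_nonneg (h : IsLargeSample H d a N K ε) : 0 ≤ Real.log (K * H * N) :=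
  Real.log_nonneg (by linarith [h.three_le_mul_mul])

theorem radius_bounds (h : IsLargeSample H d a N K ε) {B β : ℝ} (hB : 0 ≤ B)
    (hβ : (β = 16 * (5 + B) * Real.log (K * H * N) ∧ (K : ℝ) ≤ B * sampleSize H d a N ε) ∨
      β = 16 * (5 + B) * (Real.log (K * H * N) + K * scale H d a ε)) :
    80 * Real.log (K * H * N) + 16 * (K * scale H d a ε) ≤ β ∧
      β ≤ 16 * (5 + B) * (Real.log (K * H * N) + K * scale H d a ε) := by
  have hlog := h.log_nonneg
  have hBlog : 0 ≤ B * Real.log (K * H * N) := mul_nonneg hB hlog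
  have hKs := h.one_le_mul_scale
  rcases hβ with ⟨rfl, hK⟩ | rfl
  · have hKs_le : K * scale H d a ε ≤ B * Real.log (K * H * N) := by
      rw [sampleSize_eq, mul_left_comm, le_inv_mul_iff₀ h.scale_pos, mul_comm] at hK
      refine hK.trans (mul_le_mul_of_nonneg_left ?_ hB)
      exact Real.log_le_log (by linarith [h.three_le]) h.le_mul_mul
    constructor <;> nlinarith
  · constructor <;> nlinarith

theorem total_error_le (h : IsLargeSample H d a N K ε) {b β : ℝ} (hb : 0 ≤ b)
    (hβ : β ≤ b * (Real.log (K * H * N) + K * scale H d a ε)) :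
    H * (ε / H * K + d + 2 * √(d * (a * (32 * (10 * Real.log (K * H * N)) + 4 * β +
      72 * (K * scale H d a ε))) * K)) ≤ (2 + 2 * √(1352 + 20 * b)) * (K * ε) := by
  have hH : (0 : ℝ) < H := by exact_mod_cast h.horizon_pos
  have hd : (0 : ℝ) < d := by exact_mod_cast h.dim_pos
  have ha : (0 : ℝ) < a := by exact_mod_cast h.actions_pos
  have hε := h.eps_pos
  have hscale : (d : ℝ) * (a * scale H d a ε) = (ε / H) ^ 2 := by
    rw [scale]
    field_simp
  have herr : 32 * (10 * Real.log (K * H * N)) + 4 * β + 72 * (K * scale H d a ε) ≤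
      (1352 + 20 * b) * (K * scale H d a ε) := by
    have hlog := h.log_mul_mul_le
    nlinarith [mul_le_mul_of_nonneg_left hlog hb]
  have hsqrt : √(d * (a * (32 * (10 * Real.log (K * H * N)) + 4 * β +
      72 * (K * scale H d a ε))) * K) ≤ √(1352 + 20 * b) * (K * ε / H) := by
    rw [Real.sqrt_le_left (by positivity), mul_pow, Real.sq_sqrt (by positivity)]
    calc _ ≤ d * (a * ((1352 + 20 * b) * (K * scale H d a ε))) * K := by gcongr
      _ = (1352 + 20 * b) * K ^ 2 * (d * (a * scale H d a ε)) := by ring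
      _ = (1352 + 20 * b) * (K * ε / H) ^ 2 := by rw [hscale]; ring
  calc _ ≤ H * (ε / H * K + d + 2 * (√(1352 + 20 * b) * (K * ε / H))) := by gcongr
    _ = K * ε + H * d + 2 * √(1352 + 20 * b) * (K * ε) := by field_simp
    _ ≤ _ := by linarith [h.horizon_mul_dim_le]

end IsLargeSample

end Rates

theorem exists_finset_isCover {S A : Type*} {V : Set (ℕ → S → A → ℝ)} {ρ : ℝ} {N : ℕ}
    (hN : (N : ℕ∞) = coveringNumber V ρ) :
    ∃ W : Finset (ℕ → S → A → ℝ), IsCover V W ρ ∧ W.card = N := by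
  have hinf : coveringNumber V ρ = ⨅ W : {W : Set (ℕ → S → A → ℝ) // IsCover V W ρ}, W.1.encard :=
    iInf_subtype'
  have hne : Nonempty {W : Set (ℕ → S → A → ℝ) // IsCover V W ρ} := by
    by_contra hempty
    rw [not_nonempty_iff] at hempty
    rw [hinf, iInf_of_empty] at hN
    exact ENat.natCast_ne_top N hN
  obtain ⟨⟨W, hW⟩, hcard⟩ := ENat.exists_eq_iInf
    fun W : {W : Set (ℕ → S → A → ℝ) // IsCover V W ρ} => W.1.encard
  rw [← hinf, ← hN] at hcard
  have hfin : W.Finite := Set.finite_of_encard_eq_coe hcard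
  refine ⟨hfin.toFinset, by rwa [hfin.coe_toFinset], ?_⟩
  rw [hfin.encard_eq_coe_toFinset_card] at hcard
  exact_mod_cast hcard

namespace MDP

variable {S A : Type*} [MeasurableSpace S] [MeasurableSpace A] {M : MDP S A}
  {F G : ℕ → Set (S → A → ℝ)} {σ : ℕ → (S → A → ℝ) → S → A}

theorem exists_dimVBE_testFamily_le {ε : ℝ} {d : ℕ∞} (hd : M.minDimVBE F σ ε ≤ d) :
    ∃ t, M.dimVBE F σ (M.testFamily F σ t) ε ≤ d := by
  rcases min_le_iff.1 hd with hpoint | hroll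
  exacts [⟨.pointMass, hpoint⟩, ⟨.rollIn, hroll⟩]

theorem IsVGolf.outputProb_eq_one [Finite A] [Nonempty A] [MeasurableSingletonClass A] {K : ℕ}
    {β η : ℝ} {sel : (k : ℕ) → (Fin k → M.Epoch) → ℕ → S → A → ℝ}
    (hsel : M.IsVGolf F G σ K β sel) (ha : M.Admissible F G σ) (hK : 0 < K) (hη : 1 ≤ η) :
    M.outputProb σ sel K (M.IsOptimalUpTo η) = 1 := by
  have := hsel.isProbabilityMeasure_dataLaw ha
  have : Nonempty (Fin K) := ⟨⟨0, hK⟩⟩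
  have huniv : {x : (Fin K → M.Epoch) × Fin K |
      M.IsOptimalUpTo η (M.policyAt σ sel x.1 x.2)} = Set.univ :=
    Set.eq_univ_of_forall fun x => ha.isOptimalUpTo_of_one_le hη _
  rw [outputProb, huniv, measure_univ]

end MDP

end

end VGolf

theorem mainTheorem7 :
    ∀ B : ℝ, 1 ≤ B → ∃ c C₁ C₂ : ℝ, 0 < c ∧ 0 < C₁ ∧ 0 < C₂ ∧
      ∀ (S : Type*) (A : Type*) [MeasurableSpace S] [MeasurableSpace A]
        [MeasurableSingletonClass A] [Fintype A] [Nonempty A]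
        (M : VGolf.MDP S A) (F G : ℕ → Set (S → A → ℝ))
        (σ : ℕ → (S → A → ℝ) → S → A),
        M.IsValueClass F → M.IsValueClass G → M.IsGreedy F σ →
        M.Realizable F → M.GeneralizedComplete F G →
        ∀ (ε : ℝ), 0 < ε →
        ∀ (d N K : ℕ),
          (d : ℕ∞) = max 1 (M.minDimVBE F σ (ε / M.H)) →
          (N : ℕ∞) = VGolf.coveringNumber (M.tuples F ∪ M.tuples G)
            (VGolf.scale M.H d (Fintype.card A) ε) →
          1 ≤ K →
          C₁ * VGolf.sampleSize M.H d (Fintype.card A) N ε ≤ K →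
        ∀ β : ℝ,
          (β = c * Real.log (K * M.H * N) ∧
              (K : ℝ) ≤ B * C₁ * VGolf.sampleSize M.H d (Fintype.card A) N ε) ∨
            β = c * (Real.log (K * M.H * N) + K * VGolf.scale M.H d (Fintype.card A) ε) →
        ∀ sel : (k : ℕ) → (Fin k → M.Epoch) → ℕ → S → A → ℝ,
          M.IsVGolf F G σ K β sel →
          ENNReal.ofReal 0.99 ≤ M.outputProb σ sel K (M.IsOptimalUpTo (C₂ * ε)) := by
  intro B hB
  refine ⟨16 * (5 + B), 1, 200 * (2 + 2 * √(1352 + 20 * (16 * (5 + B)))), by positivity, one_pos,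
    by positivity, ?_⟩
  intro S A _ _ _ _ _ M F G σ hF hG hσ hR hC ε hε d N K hd hN hK hKT β hβ sel hsel
  simp only [one_mul, mul_one] at hKT hβ
  have ha : M.Admissible F G σ := ⟨hF, hG, hσ, hR, hC⟩
  rcases le_or_gt (1 / 3) ε with hε3 | hε3
  · have hη : 1 ≤ 200 * (2 + 2 * √(1352 + 20 * (16 * (5 + B)))) * ε := by
      nlinarith [Real.sqrt_nonneg (1352 + 20 * (16 * (5 + B)))]
    rw [hsel.outputProb_eq_one ha hK hη, ENNReal.ofReal_le_one]
    norm_num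
  obtain ⟨t, ht⟩ := VGolf.MDP.exists_dimVBE_testFamily_le (hd ▸ le_max_right _ _)
  obtain ⟨W, hW, rfl⟩ := VGolf.exists_finset_isCover hN
  obtain ⟨w, hw, -⟩ := hW.2 _ (Or.inl ha.optimalQ_mem)
  have hs : VGolf.IsLargeSample M.H d (Fintype.card A) W.card K ε :=
    ⟨M.H_pos, by exact_mod_cast hd ▸ le_max_left (1 : ℕ∞) _, Fintype.card_pos,
      Finset.card_pos.2 ⟨w, hw⟩, hε, hε3, hKT⟩
  obtain ⟨hβ_ge, hβ_le⟩ := hs.radius_bounds (by linarith) hβ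
  rw [show (0.99 : ℝ) = 1 - 2 * 0.005 by norm_num]
  refine hsel.ofReal_one_sub_le_outputProb (θ := 10 * Real.log (K * M.H * W.card)) (δ := 0.005) ha
    (div_pos hε (Nat.cast_pos.2 M.H_pos)) ht hW hs.scale_pos.le (by linarith [hs.log_nonneg])
    (by linarith) hK (by positivity) (by norm_num)
    (VGolf.two_mul_mul_exp_neg_ten_mul_log_le hs.three_le_mul_mul) ?_
  exact (hs.total_error_le (by positivity) hβ_le).trans_eq (by ring)
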